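/- Let $M\ge N\ge 7$ be integers, let $B^N$ be the open unit ball of $\mathbb R^N$, and regard $\mathbb R^N\subset\mathbb R^M$ via $x\mapsto(x,0)$. Let $W\in C^1((-\infty,1];\mathbb R)$ be convex with $W(0)=0$ and $W(t)>0$ for all $t\in(-\infty,1]\setminus\{0\}$. For $\varepsilon>0$ consider $$E_\varepsilon(u)=\int_{B^N}\Big[\tfrac12|\nabla u|^2+\tfrac1{2\varepsilon^2}W(1-|u|^2)\Big]dx\in[0,\infty]$$ on the set $\mathcal A=\{u\in H^1(B^N;\mathbb R^M): u(x)=x \text{ on }\partial B^N\}$, where the boundary condition is meant in the sense of traces, i.e. $u-x\in H^1_0(B^N;\mathbb R^M)$. Then for every $\varepsilon>0$ the following holds. The boundary value problem $$-f''-\frac{N-1}{r}f'+\frac{N-1}{r^2}f=\frac1{\varepsilon^2}\,f\,W'(1-f^2)\ \text{ in }(0,1),\qquad f(0)=0,\quad f(1)=1,$$ has exactly one solution $f_\varepsilon:[0,1]\to[0,\infty)$ that is continuous on $[0,1]$ and $C^2$ in $(0,1)$, and the map $$u_\varepsilon(x)=f_\varepsilon(|x|)\frac{x}{|x|}$$ is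 the unique global minimizer of $E_\varepsilon$ in $\mathcal A$: $u_\varepsilon\in\mathcal A$, $E_\varepsilon(u_\varepsilon)\le E_\varepsilon(w)$ for all $w\in\mathcal A$, and every global minimizer of $E_\varepsilon$ in $\mathcal A$ equals $u_\varepsilon$ almost everywhere in $B^N$. -/

import Mathlib

open MeasureTheory Set Filter Topology
open scoped ENNReal ContDiff

noncomputable section

namespace GinzburgLandau

/-- The Euclidean space `ℝⁿ`. -/
abbrev E (n : ℕ) : Type := EuclideanSpace ℝ (Fin n)

/-- The open unit ball `B^N` of `ℝ^N`. -/
def unitBall (N : ℕ) : Set (E N) := Metric.ball 0 1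

/-- Lebesgue measure on the unit ball `B^N`. -/
def ballMeasure (N : ℕ) : Measure (E N) := volume.restrict (unitBall N)

/-- The assumptions on the potential `W ∈ C¹((-∞,1]; ℝ)`; only values on `(-∞,1]` matter. -/
structure IsPotential (W : ℝ → ℝ) : Prop where
  contDiffOn : ContDiffOn ℝ 1 W (Iic 1)
  map_zero : W 0 = 0
  pos : ∀ t ∈ Iic (1 : ℝ), t ≠ 0 → 0 < W t
  convexOn : ConvexOn ℝ (Iic 1) W

/-- `W'` on `(-∞,1]` (one-sided at the endpoint `1`). -/
def potentialDeriv (W : ℝ → ℝ) (t : ℝ) : ℝ := derivWithin W (Iic 1) t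

/-- The classical partial derivative `∂ᵢ φ`. -/
def partialDeriv {N : ℕ} {F : Type*} [NormedAddCommGroup F] [NormedSpace ℝ F]
    (i : Fin N) (φ : E N → F) (x : E N) : F :=
  fderiv ℝ φ x (EuclideanSpace.single i 1)

/-- `φ ∈ C_c^∞(B^N; F)`. -/
structure IsTestFunction {N : ℕ} {F : Type*} [NormedAddCommGroup F] [NormedSpace ℝ F]
    (φ : E N → F) : Prop where
  contDiff : ContDiff ℝ ∞ φ
  hasCompactSupport : HasCompactSupport φ
  tsupport_subset : tsupport φ ⊆ unitBall N

/-- `G` is an `L²` weak gradient of `u` on `B^N`: `G x i ∈ ℝ^M` is the weak partial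
derivative `∂ᵢ u (x)`. -/
structure IsWeakGradient {N M : ℕ} (u : E N → E M) (G : E N → Fin N → E M) : Prop where
  memLp : ∀ i, MemLp (fun x => G x i) 2 (ballMeasure N)
  integral_eq : ∀ φ : E N → ℝ, IsTestFunction φ → ∀ i,
    ∫ x, partialDeriv i φ x • u x ∂(ballMeasure N) = -∫ x, φ x • G x i ∂(ballMeasure N)

/-- `u ∈ H¹(B^N; ℝ^M)`. -/
def MemH1 {N M : ℕ} (u : E N → E M) : Prop :=
  MemLp u 2 (ballMeasure N) ∧ ∃ G, IsWeakGradient u G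

open Classical in
/-- The weak gradient of `u`, which is unique almost everywhere when `u ∈ H¹`. -/
def weakGradient {N M : ℕ} (u : E N → E M) : E N → Fin N → E M :=
  if h : ∃ G, IsWeakGradient u G then h.choose else 0

/-- `v ∈ H¹₀(B^N; ℝ^M)`, the closure of `C_c^∞(B^N; ℝ^M)` in the `H¹` norm. -/
def MemH10 {N M : ℕ} (v : E N → E M) : Prop :=
  MemH1 v ∧ ∃ φ : ℕ → E N → E M, (∀ k, IsTestFunction (φ k)) ∧
    Tendsto (fun k => eLpNorm (fun x => v x - φ k x) 2 (ballMeasure N)) atTop (𝓝 0) ∧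
    ∀ i, Tendsto (fun k => eLpNorm (fun x => weakGradient v x i - partialDeriv i (φ k) x) 2
      (ballMeasure N)) atTop (𝓝 0)

/-- The inclusion `ℝ^N ⊂ ℝ^M`, `x ↦ (x, 0)`, for `N ≤ M`. -/
def incl (N M : ℕ) (x : E N) : E M :=
  WithLp.toLp 2 fun j => if h : (j : ℕ) < N then x ⟨j, h⟩ else 0

/-- The class `𝒜` of maps `u ∈ H¹(B^N; ℝ^M)` with `u(x) = x` on `∂B^N` in the sense of traces,
that is, `u - x ∈ H¹₀(B^N; ℝ^M)`. -/
def admissible (N M : ℕ) : Set (E N → E M) :=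
  {u | MemH1 u ∧ MemH10 (fun x => u x - incl N M x)}

/-- The energy `E_ε(u) = ∫_{B^N} ½ |∇u|² + 1/(2ε²) W(1 - |u|²) dx`, where
`|∇u|² = ∑ᵢ |∂ᵢ u|²`; the integrand is nonnegative and the value may be `∞`. -/
def energy {N M : ℕ} (W : ℝ → ℝ) (ε : ℝ) (u : E N → E M) : ℝ≥0∞ :=
  ∫⁻ x, ENNReal.ofReal
    (1 / 2 * ∑ i, ‖weakGradient u x i‖ ^ 2 + 1 / (2 * ε ^ 2) * W (1 - ‖u x‖ ^ 2))
    ∂(ballMeasure N)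

/-- `u` is a global minimizer of `E_ε` in `𝒜`. -/
def IsGlobalMinimizer {N M : ℕ} (W : ℝ → ℝ) (ε : ℝ) (u : E N → E M) : Prop :=
  u ∈ admissible N M ∧ ∀ w ∈ admissible N M, energy W ε u ≤ energy W ε w

/-- `f : [0,1] → [0,∞)` is a (classical) solution of the boundary value problem
`-f'' - (N-1)/r f' + (N-1)/r² f = ε⁻² f W'(1 - f²)` in `(0,1)`, `f(0) = 0`, `f(1) = 1`. -/
structure IsRadialProfile (N : ℕ) (W : ℝ → ℝ) (ε : ℝ) (f : ℝ → ℝ) : Prop where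
  continuousOn : ContinuousOn f (Icc 0 1)
  contDiffOn : ContDiffOn ℝ 2 f (Ioo 0 1)
  nonneg : ∀ r ∈ Icc (0 : ℝ) 1, 0 ≤ f r
  ode : ∀ r ∈ Ioo (0 : ℝ) 1,
    -deriv (deriv f) r - ((N : ℝ) - 1) / r * deriv f r + ((N : ℝ) - 1) / r ^ 2 * f r
      = 1 / ε ^ 2 * (f r * potentialDeriv W (1 - f r ^ 2))
  map_zero : f 0 = 0
  map_one : f 1 = 1

/-- The map `x ↦ f(|x|) x/|x|` with values in `ℝ^N ⊂ ℝ^M` (and value `0` at the origin). -/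
def radialMap (N M : ℕ) (f : ℝ → ℝ) (x : E N) : E M :=
  (f ‖x‖ / ‖x‖) • incl N M x

end GinzburgLandau

end

open GinzburgLandau

/-! Put V(y) = ε⁻² W'(1 - y²). By convexity of W, V is decreasing in y ≥ 0, and V(1) = 0 since 0
minimises W. Let f be a radial profile and u(x) = f(|x|) x/|x|. The core is the quantitative
estimate E(u + v) ≥ E(u) + (1/32) ∫|v|² for v in H¹₀ (`ProfileData.energy_ge`), which yields
minimality and uniqueness of the minimizer at once.

W lies above its tangent at 1 - |u|², so E(u + v) - E(u) is at least ∫(∇u·∇v - V(|u|) u·v) + ½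
∫(|∇v|² - V(|u|)|v|²). The linear term vanishes by the Euler-Lagrange equation
(`ProfileData.euler_lagrange`). The quadratic term is at least (1/32) ∫|v|² by a Hardy-type
inequality (`ProfileData.hardy`). Formally, v = fψ turns it into ½ ∫ f²(|∇ψ|² - (N-1)|ψ|²/r²). Since
f' ≥ 0, the weight f² does no harm to Hardy's constant (N-2)²/4. For N ≥ 2 that constant exceeds N -
1 exactly when N ≥ 7. Rigorously, one completes the square with the bounded field X = -∇ log(F(r)(r²
+ δ)^(-κ/2)), where F = f/r and κ = (N-4)/2; thus δ > 0 regularises the weight f r^(-(N-2)/2).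

For existence the unknown is F, which solves (r^(N+1) F')' = -r^(N+1) V(rF) F and is regular at the
origin: F' = -r m with m continuous. After truncating V, Tonelli's delayed equation is solved
explicitly, its initial value is adjusted by the intermediate value theorem so that F(1) = 1, and
the delay is removed by Arzelà-Ascoli (`exists_integral_solution`). A maximum principle gives f ≤ 1,
which removes the truncation, and a non-oscillation argument gives f' ≥ 0 (`exists_profileData`).

Uniqueness of the profile is a Wronskian comparison: where f > g, monotonicity of V makes
r^(N-1)(f'g - fg') increasing, which prevents f/g from returning to 1
(`IsRadialProfile.le_of_profile`). Since profiles are only assumed continuous at 0, their behaviour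
there is first controlled through the flux r^(N+1)(g/r)'. -/

namespace GinzburgLandau

/-! ### Tonelli's delayed equation and shooting -/

/-- The integrand `s ∫₀¹ τⁿ h(sτ, g(sτ)) dτ` of the radial integral equation. -/
noncomputable def radialAverage (n : ℕ) (h : ℝ → ℝ → ℝ) (g : ℝ → ℝ) (s : ℝ) : ℝ :=
  s * ∫ τ in (0:ℝ)..1, τ ^ n * h (s * τ) (g (s * τ))

/-- Tonelli's delayed iterates for the radial integral equation with initial value `a`. -/
noncomputable def delayedIterate (n : ℕ) (h : ℝ → ℝ → ℝ) (d : ℝ) : ℕ → ℝ → ℝ → ℝ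
  | 0, a, _ => a
  | j + 1, a, r => a - ∫ s in (0:ℝ)..r,
      radialAverage n h (fun t => delayedIterate n h d j a (max (t - d) 0)) s

variable {n : ℕ} {h : ℝ → ℝ → ℝ} {C : ℝ}

/-- Joint continuity includes the initial value a. This is what makes shooting possible although h
is merely continuous and solutions of the undelayed equation need not depend continuously on a. -/
theorem continuous_delayedIterate (hc : Continuous (Function.uncurry h)) (d : ℝ) (j : ℕ) :
    Continuous (fun p : ℝ × ℝ => delayedIterate n h d j p.1 p.2) := by
  induction j with
  | zero => simpa only [delayedIterate] using continuous_fst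
  | succ j ih =>
    simp only [delayedIterate]
    refine continuous_fst.sub ?_
    refine intervalIntegral.continuous_parametric_primitive_of_continuous
      (f := fun (a s : ℝ) => radialAverage n h
        (fun t => delayedIterate n h d j a (max (t - d) 0)) s) (μ := volume) (a₀ := 0) ?_
    simp only [Function.uncurry_def, radialAverage]
    refine continuous_snd.mul ?_
    refine intervalIntegral.continuous_parametric_intervalIntegral_of_continuous'
      (f := fun (p : ℝ × ℝ) (τ : ℝ) => τ ^ n * h (p.2 * τ)
        (delayedIterate n h d j p.1 (max (p.2 * τ - d) 0))) ?_ 0 1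
    simp only [Function.uncurry_def]
    refine (continuous_snd.pow n).mul (hc.comp₂ (by fun_prop) ?_)
    exact ih.comp (f := fun q : (ℝ × ℝ) × ℝ => (q.1.1, max (q.1.2 * q.2 - d) 0)) (by fun_prop)

theorem continuous_radialAverage (hc : Continuous (Function.uncurry h)) {g : ℝ → ℝ}
    (hg : Continuous g) : Continuous (radialAverage n h g) := by
  unfold radialAverage
  refine continuous_id.mul ?_
  refine intervalIntegral.continuous_parametric_intervalIntegral_of_continuous'
      (f := fun (s : ℝ) (τ : ℝ) => τ ^ n * h (s * τ) (g (s * τ))) ?_ 0 1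
  simp only [Function.uncurry_def]
  exact (continuous_snd.pow n).mul (hc.comp₂ (by fun_prop) (hg.comp (by fun_prop)))

theorem radialAverage_nonneg (h0 : ∀ t y, 0 ≤ h t y) (g : ℝ → ℝ) {s : ℝ} (hs : 0 ≤ s) :
    0 ≤ radialAverage n h g s :=
  mul_nonneg hs (intervalIntegral.integral_nonneg zero_le_one fun _ hτ =>
    mul_nonneg (pow_nonneg hτ.1 n) (h0 _ _))

/-- One factor τ of τⁿ is paired with the prefactor s, so a bound on t h(t, y) suffices; h(t, y)
itself is unbounded in y near t = 0 in the application. -/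
theorem radialAverage_le (hc : Continuous (Function.uncurry h)) (hn : n ≠ 0)
    (hC : ∀ t y, 0 ≤ t → t * h t y ≤ C) (hC0 : 0 ≤ C) {g : ℝ → ℝ}
    (hg : Continuous g) {s : ℝ} (hs : 0 ≤ s) :
    radialAverage n h g s ≤ C := by
  unfold radialAverage
  rw [← intervalIntegral.integral_const_mul]
  have hb : ∀ τ ∈ Icc (0:ℝ) 1, s * (τ ^ n * h (s * τ) (g (s * τ))) ≤ C := by
    intro τ hτ
    obtain ⟨k, rfl⟩ := Nat.exists_eq_succ_of_ne_zero hn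
    have e1 : s * (τ ^ (k+1) * h (s * τ) (g (s * τ)))
      = τ ^ k * ((s * τ) * h (s * τ) (g (s * τ))) := by ring
    rw [Nat.succ_eq_add_one, e1]
    calc _ ≤ τ ^ k * C :=
          mul_le_mul_of_nonneg_left (hC _ _ (mul_nonneg hs hτ.1)) (pow_nonneg hτ.1 k)
      _ ≤ 1 * C := mul_le_mul_of_nonneg_right (pow_le_one₀ hτ.1 hτ.2) hC0
      _ = C := one_mul C
  have hcont : Continuous fun τ : ℝ => s * (τ ^ n * h (s * τ) (g (s * τ))) :=
    continuous_const.mul ((continuous_id.pow n).mul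
      (hc.comp₂ (by fun_prop) (hg.comp (by fun_prop))))
  calc _ ≤ ∫ _ in (0:ℝ)..1, C := intervalIntegral.integral_mono_on zero_le_one
          (hcont.intervalIntegrable 0 1) (by simp) hb
    _ = C := by simp

/-- On [0, (j+1)d] an iterate only sees its predecessor on [0, jd], because of the delay. Hence
finitely many iterations solve the delayed equation exactly on [0, 1]. -/
theorem delayedIterate_succ_eq {d : ℝ} (hd : 0 < d) (a : ℝ) (j : ℕ) {r : ℝ} (hr : 0 ≤ r)
    (hrj : r ≤ j * d) : delayedIterate n h d (j + 1) a r = delayedIterate n h d j a r := by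
  induction j generalizing r with
  | zero =>
    have : r = 0 := le_antisymm (by simpa using hrj) hr
    subst this
    simp [delayedIterate]
  | succ j ih =>
    rw [delayedIterate]
    conv_rhs => rw [delayedIterate]
    congr 1
    refine intervalIntegral.integral_congr fun s hs => ?_
    rw [uIcc_of_le hr] at hs
    simp only [radialAverage]
    congr 1
    refine intervalIntegral.integral_congr fun τ hτ => ?_
    rw [uIcc_of_le zero_le_one] at hτ
    rw [ih (le_max_right _ _)]
    have h1 : s * τ ≤ s * 1 := mul_le_mul_of_nonneg_left hτ.2 hs.1
    push_cast at hrj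
    refine max_le (by linarith [hs.2]) (by positivity)

/-- Solutions of the delayed equation, with the value `1` at `r = 1`. -/
theorem exists_delayed_solution (hc : Continuous (Function.uncurry h)) (hn : n ≠ 0)
    (h0 : ∀ t y, 0 ≤ h t y) (hC : ∀ t y, 0 ≤ t → t * h t y ≤ C) {d : ℝ} (hd : 0 < d) :
    ∃ G : ℝ → ℝ, Continuous G ∧ G 1 = 1 ∧ ∀ r ∈ Icc (0:ℝ) 1,
      G r = G 0 - ∫ s in (0:ℝ)..r, radialAverage n h (fun t => G (max (t - d) 0)) s := by
  have hC0 : 0 ≤ C := by simpa using hC 0 0 le_rfl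
  obtain ⟨j, hj⟩ := exists_nat_gt (1 / d)
  have hjd : 1 ≤ (j : ℝ) * d := by
    rw [div_lt_iff₀ hd] at hj; exact hj.le
  have hjc := continuous_delayedIterate (n := n) hc d j
  have hcd : ∀ a, Continuous fun t => delayedIterate n h d j a (max (t - d) 0) := fun a =>
    hjc.comp₂ (by fun_prop) (by fun_prop)
  have key : ∀ a, ∀ r ∈ Icc (0:ℝ) 1, delayedIterate n h d j a r = a - ∫ s in (0:ℝ)..r,
      radialAverage n h (fun t => delayedIterate n h d j a (max (t - d) 0)) s := fun a r hr => by
    rw [← delayedIterate_succ_eq hd a j hr.1 (hr.2.trans hjd)]; rfl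
  have hi : ∀ a, IntervalIntegrable (radialAverage n h
      (fun t => delayedIterate n h d j a (max (t - d) 0))) volume 0 1 := fun a =>
    (continuous_radialAverage hc (hcd a)).intervalIntegrable 0 1
  have h1 : ∀ a, delayedIterate n h d j a 1 ≤ a := fun a => by
    rw [key a 1 (by simp)]
    linarith [intervalIntegral.integral_nonneg (μ := volume) (zero_le_one (α := ℝ))
      fun s (hs : s ∈ Icc (0:ℝ) 1) => radialAverage_nonneg (n := n) h0
        (fun t => delayedIterate n h d j a (max (t - d) 0)) hs.1]
  have h2 : ∀ a, a - C ≤ delayedIterate n h d j a 1 := fun a => by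
    rw [key a 1 (by simp)]
    have := intervalIntegral.integral_mono_on zero_le_one (hi a)
      (intervalIntegrable_const (c := C))
      fun s hs => radialAverage_le hc hn hC hC0 (hcd a) hs.1
    simp only [intervalIntegral.integral_const, sub_zero, one_smul] at this
    linarith
  have hcont : Continuous fun a => delayedIterate n h d j a 1 :=
    hjc.comp₂ continuous_id continuous_const
  -- The value at 1 lies between a - C and a, so it is at most 1 for a = 1 and at least 1 for a = 1
  -- + C.
  obtain ⟨a, -, ha⟩ := intermediate_value_Icc (show (1:ℝ) ≤ 1 + C by linarith) hcont.continuousOn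
    ⟨h1 1, by linarith [h2 (1 + C)]⟩
  have ha0 : delayedIterate n h d j a 0 = a := by
    rw [key a 0 (by simp)]; simp
  refine ⟨fun r => delayedIterate n h d j a r, hjc.comp₂ continuous_const continuous_id, ha, ?_⟩
  intro r hr
  simp only [ha0]
  exact key a r hr

end GinzburgLandau

/-! ### Removing the delay by compactness -/

namespace GinzburgLandau
variable {n : ℕ} {h : ℝ → ℝ → ℝ} {C : ℝ}

/-- Existence for the radial integral equation `F(r) = F(0) - ∫₀ʳ s ∫₀¹ τⁿ h(sτ, F(sτ)) dτ ds`
with `F(1) = 1`. -/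
theorem exists_integral_solution (hc : Continuous (Function.uncurry h)) (hn : n ≠ 0)
    (h0 : ∀ t y, 0 ≤ h t y) (hC : ∀ t y, 0 ≤ t → t * h t y ≤ C) :
    ∃ F : ℝ → ℝ, Continuous F ∧ F 1 = 1 ∧ ∀ r ∈ Icc (0:ℝ) 1,
      F r = F 0 - ∫ s in (0:ℝ)..r, radialAverage n h F s := by
  have hC0 : 0 ≤ C := by simpa using hC 0 0 le_rfl
  have hd : ∀ k : ℕ, (0:ℝ) < 1 / ((k:ℝ) + 1) := fun k => Nat.one_div_pos_of_nat
  choose G hGc hG1 hG using fun k => exists_delayed_solution hc hn h0 hC (hd k)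
  have hGd : ∀ k, Continuous fun t => G k (max (t - 1 / ((k:ℝ) + 1)) 0) := fun k =>
    (hGc k).comp (by fun_prop)
  set A : ℕ → ℝ → ℝ := fun k =>
    radialAverage n h (fun t => G k (max (t - 1 / ((k:ℝ) + 1)) 0)) with hA
  have hAc : ∀ k, Continuous (A k) := fun k => continuous_radialAverage hc (hGd k)
  have hA0 : ∀ k, ∀ s ∈ Icc (0:ℝ) 1, 0 ≤ A k s := fun k s hs => radialAverage_nonneg h0 _ hs.1
  have hA1 : ∀ k, ∀ s ∈ Icc (0:ℝ) 1, A k s ≤ C := fun k s hs =>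
    radialAverage_le hc hn hC hC0 (hGd k) hs.1
  -- The slopes lie in [-C, 0] whatever the delay. Together with the value 1 at r = 1, this gives
  -- uniform bounds and a uniform Lipschitz constant.
  have hdiff : ∀ k, ∀ r ∈ Icc (0:ℝ) 1, ∀ r' ∈ Icc (0:ℝ) 1, r ≤ r' →
      0 ≤ G k r - G k r' ∧ G k r - G k r' ≤ C * (r' - r) := by
    intro k r hr r' hr' hrr
    have e : G k r - G k r' = ∫ s in r..r', A k s := by
      rw [hG k r hr, hG k r' hr', ← intervalIntegral.integral_interval_sub_left (μ := volume)
        ((hAc k).intervalIntegrable 0 r') ((hAc k).intervalIntegrable 0 r)]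
      ring
    have hs : ∀ s ∈ Icc r r', s ∈ Icc (0:ℝ) 1 := fun s hs => ⟨hr.1.trans hs.1, hs.2.trans hr'.2⟩
    rw [e]
    refine ⟨intervalIntegral.integral_nonneg (μ := volume) hrr fun s hs' => hA0 k s (hs s hs'), ?_⟩
    have := intervalIntegral.integral_mono_on (μ := volume) hrr ((hAc k).intervalIntegrable r r')
      (intervalIntegrable_const (c := C)) fun s hs' => hA1 k s (hs s hs')
    simpa [mul_comm] using this
  have hLip : ∀ k, ∀ r ∈ Icc (0:ℝ) 1, ∀ r' ∈ Icc (0:ℝ) 1,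
      |G k r - G k r'| ≤ C * |r - r'| := by
    intro k r hr r' hr'
    rcases le_total r r' with hrr | hrr
    · obtain ⟨h1, h2⟩ := hdiff k r hr r' hr' hrr
      rw [abs_of_nonneg h1, abs_of_nonpos (by linarith)]; linarith
    · obtain ⟨h1, h2⟩ := hdiff k r' hr' r hr hrr
      rw [abs_of_nonpos (by linarith), abs_of_nonneg (by linarith)]; linarith
  have hbd : ∀ k, ∀ r ∈ Icc (0:ℝ) 1, G k r ∈ Icc 1 (1 + C) := by
    intro k r hr
    obtain ⟨h1, h2⟩ := hdiff k r hr 1 (by simp) hr.2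
    rw [hG1] at h1 h2
    constructor <;> nlinarith [hr.1]
  -- compactness
  let S : Set (BoundedContinuousFunction (Icc (0:ℝ) 1) ℝ) :=
    {g | (∀ x, g x ∈ Icc 1 (1 + C)) ∧ ∀ x y, |g x - g y| ≤ C * |(x:ℝ) - y|}
  have hev : ∀ x, Continuous fun g : BoundedContinuousFunction (Icc (0:ℝ) 1) ℝ => g x :=
    fun x => (continuous_apply x).comp BoundedContinuousFunction.continuous_coe
  have hSclosed : IsClosed S := by
    simp only [S, Set.ofPred_and, Set.ofPred_forall]
    refine IsClosed.inter (isClosed_iInter fun x => ?_) (isClosed_iInter fun x =>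
      isClosed_iInter fun y => ?_)
    · exact isClosed_Icc.preimage (hev x)
    · exact isClosed_le (((hev x).sub
        (hev y)).abs) continuous_const
  have hScomp : IsCompact S := by
    refine BoundedContinuousFunction.arzela_ascoli₂ (Icc 1 (1 + C)) isCompact_Icc S hSclosed
      (fun f x hf => hf.1 x) ?_
    refine (LipschitzWith.uniformEquicontinuous (fun f : S => (f.1 : Icc (0:ℝ) 1 → ℝ))
      C.toNNReal ?_).equicontinuous
    intro f
    refine LipschitzWith.of_dist_le_mul fun x y => ?_
    rw [Real.coe_toNNReal _ hC0, Real.dist_eq]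
    exact f.2.2 x y
  let g : ℕ → BoundedContinuousFunction (Icc (0:ℝ) 1) ℝ := fun k =>
    BoundedContinuousFunction.mkOfCompact ⟨fun x => G k x, (hGc k).comp continuous_subtype_val⟩
  have hgS : ∀ k, g k ∈ S := fun k => ⟨fun x => hbd k x x.2, fun x y => hLip k x x.2 y y.2⟩
  obtain ⟨g₀, -, φ, hφ, hlim⟩ := hScomp.tendsto_subseq hgS
  have hpt : ∀ r (hr : r ∈ Icc (0:ℝ) 1), Tendsto (fun k => G (φ k) r) atTop (𝓝 (g₀ ⟨r, hr⟩)) :=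
    fun r hr =>
      ((hev ⟨r, hr⟩).tendsto g₀).comp hlim
  let F : ℝ → ℝ := IccExtend zero_le_one g₀
  have hFc : Continuous F := g₀.continuous.Icc_extend'
  have hF : ∀ r (hr : r ∈ Icc (0:ℝ) 1), Tendsto (fun k => G (φ k) r) atTop (𝓝 (F r)) :=
    fun r hr => by
      simp only [F, IccExtend_of_mem zero_le_one _ hr]; exact hpt r hr
  refine ⟨F, hFc, ?_, fun r hr => ?_⟩
  · exact tendsto_nhds_unique (hF 1 (by simp)) (by simp [hG1])
  -- passage to the limit
  have hdlim : Tendsto (fun k => 1 / ((φ k : ℝ) + 1)) atTop (𝓝 0) :=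
    tendsto_one_div_add_atTop_nhds_zero_nat.comp hφ.tendsto_atTop
  have hmax : ∀ k : ℕ, ∀ t ∈ Icc (0:ℝ) 1, max (t - 1 / ((k:ℝ) + 1)) 0 ∈ Icc (0:ℝ) 1 :=
    fun k t ht => ⟨le_max_right _ _, max_le (by linarith [ht.2, (hd k).le]) zero_le_one⟩
  have hdel : ∀ t ∈ Icc (0:ℝ) 1,
      Tendsto (fun k => G (φ k) (max (t - 1 / ((φ k : ℝ) + 1)) 0)) atTop (𝓝 (F t)) := by
    intro t ht
    -- The delay moves the argument by at most 1/(φ k + 1), so equi-Lipschitz continuity makes its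
    -- effect disappear in the limit.
    have hz : Tendsto (fun k => G (φ k) (max (t - 1 / ((φ k : ℝ) + 1)) 0) - G (φ k) t)
        atTop (𝓝 0) := by
      refine squeeze_zero_norm (fun k => (hLip _ _ (hmax (φ k) t ht) t ht)) ?_
      have : Tendsto (fun k => C * |max (t - 1 / ((φ k : ℝ) + 1)) 0 - t|) atTop
          (𝓝 (C * |max (t - 0) 0 - t|)) :=
        (((tendsto_const_nhds.sub hdlim).max tendsto_const_nhds).sub_const t).abs.const_mul C
      simpa [max_eq_left ht.1] using this
    simpa using hz.add (hF t ht)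
  -- The a priori range [1, 1 + C] is compact, so h is bounded on all values that occur and can be
  -- dominated.
  obtain ⟨K, hK⟩ : ∃ K, ∀ t ∈ Icc (0:ℝ) 1, ∀ y ∈ Icc 1 (1 + C), h t y ≤ K := by
    obtain ⟨K, hK⟩ := ((isCompact_Icc (a := (0:ℝ)) (b := 1)).prod
      (isCompact_Icc (a := (1:ℝ)) (b := 1 + C))).bddAbove_image hc.continuousOn
    exact ⟨K, fun t ht y hy => hK ⟨(t, y), ⟨ht, hy⟩, rfl⟩⟩
  have hprod : ∀ s ∈ Icc (0:ℝ) 1, ∀ τ ∈ Icc (0:ℝ) 1, s * τ ∈ Icc (0:ℝ) 1 := fun s hs τ hτ =>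
    ⟨mul_nonneg hs.1 hτ.1, mul_le_one₀ hs.2 hτ.1 hτ.2⟩
  have hAlim : ∀ s ∈ Icc (0:ℝ) 1,
      Tendsto (fun k => A (φ k) s) atTop (𝓝 (radialAverage n h F s)) := by
    intro s hs
    refine Tendsto.const_mul s ?_
    refine intervalIntegral.tendsto_integral_filter_of_dominated_convergence (fun _ => K) ?_ ?_
      intervalIntegrable_const ?_
    · refine Eventually.of_forall fun k => Continuous.aestronglyMeasurable ?_
      exact (continuous_id.pow n).mul (hc.comp₂ (by fun_prop) ((hGd _).comp (by fun_prop)))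
    · refine Eventually.of_forall fun k => Eventually.of_forall fun τ hτ => ?_
      rw [uIoc_of_le zero_le_one] at hτ
      have hτ' := Ioc_subset_Icc_self hτ
      have hh := hK _ (hprod s hs τ hτ') _ (hbd (φ k) _ (hmax (φ k) _ (hprod s hs τ hτ')))
      rw [Real.norm_of_nonneg (mul_nonneg (pow_nonneg hτ'.1 n) (h0 _ _))]
      exact (mul_le_of_le_one_left (h0 _ _) (pow_le_one₀ hτ'.1 hτ'.2)).trans hh
    · refine Eventually.of_forall fun τ hτ => ?_
      rw [uIoc_of_le zero_le_one] at hτ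
      refine Tendsto.const_mul _ ?_
      exact (hc.tendsto (s * τ, F (s * τ))).comp (tendsto_const_nhds.prodMk_nhds
        (hdel _ (hprod s hs τ (Ioc_subset_Icc_self hτ))))
  have hint : Tendsto (fun k => ∫ s in (0:ℝ)..r, A (φ k) s) atTop
      (𝓝 (∫ s in (0:ℝ)..r, radialAverage n h F s)) := by
    refine intervalIntegral.tendsto_integral_filter_of_dominated_convergence (fun _ => C) ?_ ?_
      intervalIntegrable_const ?_
    · exact Eventually.of_forall fun k => (hAc (φ k)).aestronglyMeasurable
    · refine Eventually.of_forall fun k => Eventually.of_forall fun s hs => ?_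
      rw [uIoc_of_le hr.1] at hs
      have hs' : s ∈ Icc (0:ℝ) 1 := ⟨hs.1.le, hs.2.trans hr.2⟩
      rw [Real.norm_of_nonneg (hA0 _ s hs')]
      exact hA1 _ s hs'
    · refine Eventually.of_forall fun s hs => ?_
      rw [uIoc_of_le hr.1] at hs
      exact hAlim s ⟨hs.1.le, hs.2.trans hr.2⟩
  refine tendsto_nhds_unique (hF r hr) ?_
  simp_rw [fun k => hG (φ k) r hr]
  exact (hF 0 (by simp)).sub hint

end GinzburgLandau

namespace GinzburgLandau

/-! ### Consequences of convexity of the potential -/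

section Potential

variable {W : ℝ → ℝ}

theorem IsPotential.differentiableOn (hW : IsPotential W) : DifferentiableOn ℝ W (Iic 1) :=
  hW.contDiffOn.differentiableOn one_ne_zero

theorem IsPotential.continuousOn_deriv (hW : IsPotential W) :
    ContinuousOn (potentialDeriv W) (Iic 1) :=
  hW.contDiffOn.continuousOn_derivWithin (uniqueDiffOn_Iic 1) le_rfl

theorem IsPotential.monotoneOn_deriv (hW : IsPotential W) :
    MonotoneOn (potentialDeriv W) (Iic 1) :=
  hW.convexOn.monotoneOn_derivWithin hW.differentiableOn

theorem IsPotential.deriv_zero (hW : IsPotential W) : potentialDeriv W 0 = 0 := by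
  have hn : Iic (1:ℝ) ∈ 𝓝 (0:ℝ) := Iic_mem_nhds zero_lt_one
  rw [potentialDeriv, derivWithin_of_mem_nhds hn]
  refine IsLocalMin.deriv_eq_zero ?_
  filter_upwards [hn] with t ht
  rw [hW.map_zero]
  rcases eq_or_ne t 0 with rfl | h
  · rw [hW.map_zero]
  · exact (hW.pos t ht h).le

theorem IsPotential.tangent_le (hW : IsPotential W) {s t : ℝ} (hs : s ≤ 1) (ht : t ≤ 1) :
    W s + potentialDeriv W s * (t - s) ≤ W t := by
  rcases lt_trichotomy s t with h | rfl | h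
  · have := hW.convexOn.derivWithin_le_slope hs ht h (hW.differentiableOn s hs)
    rw [slope_def_field, le_div_iff₀ (by linarith)] at this
    simp only [potentialDeriv]; linarith
  · simp
  · have := hW.convexOn.slope_le_derivWithin ht hs h (hW.differentiableOn s hs)
    rw [slope_def_field, div_le_iff₀ (by linarith)] at this
    simp only [potentialDeriv]; linarith

/-- The zeroth order coefficient `ε⁻² W'(1 - y²)`. -/
noncomputable def coeff (W : ℝ → ℝ) (ε y : ℝ) : ℝ := 1 / ε ^ 2 * potentialDeriv W (1 - y ^ 2)

/-- Convexity makes W' increasing, and 1 - y² decreases in y ≥ 0. This monotonicity drives both the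
monotonicity and the uniqueness of the profile. -/
theorem IsPotential.coeff_antitone (hW : IsPotential W) (ε : ℝ) {y z : ℝ} (hy : 0 ≤ y)
    (hyz : y ≤ z) : coeff W ε z ≤ coeff W ε y := by
  refine mul_le_mul_of_nonneg_left (hW.monotoneOn_deriv ?_ ?_ ?_) (by positivity)
  · simp only [mem_Iic]; nlinarith
  · simp only [mem_Iic]; nlinarith
  · nlinarith

theorem IsPotential.coeff_one (hW : IsPotential W) (ε : ℝ) : coeff W ε 1 = 0 := by
  simp [coeff, hW.deriv_zero]

theorem IsPotential.coeff_nonneg (hW : IsPotential W) (ε : ℝ) {y : ℝ} (hy : 0 ≤ y)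
    (hy1 : y ≤ 1) : 0 ≤ coeff W ε y := by
  rw [← hW.coeff_one ε]; exact hW.coeff_antitone ε hy hy1

theorem IsPotential.continuous_coeff (hW : IsPotential W) (ε : ℝ) : Continuous (coeff W ε) := by
  refine continuous_const.mul (hW.continuousOn_deriv.comp_continuous (by fun_prop) fun y => ?_)
  simp only [mem_Iic]; nlinarith [sq_nonneg y]

end Potential

/-! ### Maximum principle and absence of oscillations -/

section MaximumPrinciple

variable {f f' f'' : ℝ → ℝ}

/-- A positive second derivative would make x a local minimum as well, hence f locally constant,
hence c = 0. -/
theorem nonpos_of_isLocalMax {x c : ℝ} (hmax : IsLocalMax f x)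
    (h1 : ∀ᶠ y in 𝓝 x, HasDerivAt f (f' y) y) (h2 : HasDerivAt f' c x) : c ≤ 0 := by
  by_contra! hc
  have e1 : deriv f =ᶠ[𝓝 x] f' := h1.mono fun y hy => hy.deriv
  have hd2 : deriv (deriv f) x = c := by rw [e1.deriv_eq, h2.deriv]
  have hmin := isLocalMin_of_deriv_deriv_pos (by rw [hd2]; exact hc) hmax.deriv_eq_zero
    h1.self_of_nhds.continuousAt
  have hconst : f =ᶠ[𝓝 x] fun _ => f x := by
    filter_upwards [hmin, hmax] with y h3 h4 using le_antisymm h4 h3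
  have : deriv (deriv f) x = 0 := by
    rw [hconst.deriv.deriv_eq]; simp
  linarith

theorem nonneg_of_isLocalMin {x c : ℝ} (hmin : IsLocalMin f x)
    (h1 : ∀ᶠ y in 𝓝 x, HasDerivAt f (f' y) y) (h2 : HasDerivAt f' c x) : 0 ≤ c := by
  have := nonpos_of_isLocalMax (f := fun y => -f y) (f' := fun y => -f' y) hmin.neg
    (h1.mono fun y hy => hy.neg) h2.neg
  linarith

theorem le_one_of_max_principle (hc : ContinuousOn f (Icc 0 1)) (h0 : f 0 ≤ 1) (h1 : f 1 ≤ 1)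
    (hd1 : ∀ r ∈ Ioo (0:ℝ) 1, HasDerivAt f (f' r) r)
    (hd2 : ∀ r ∈ Ioo (0:ℝ) 1, HasDerivAt f' (f'' r) r)
    (hpos : ∀ r ∈ Ioo (0:ℝ) 1, 1 < f r → f' r = 0 → 0 < f'' r) :
    ∀ r ∈ Icc (0:ℝ) 1, f r ≤ 1 := by
  intro r hr
  obtain ⟨x, hx, hmax⟩ := isCompact_Icc.exists_isMaxOn ⟨r, hr⟩ hc
  refine (hmax hr).trans ?_
  by_contra! hgt
  have hx' : x ∈ Ioo (0:ℝ) 1 := by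
    refine ⟨lt_of_le_of_ne hx.1 ?_, lt_of_le_of_ne hx.2 ?_⟩ <;> rintro rfl <;> linarith
  have hloc : IsLocalMax f x := hmax.isLocalMax (Icc_mem_nhds hx'.1 hx'.2)
  have h3 := hpos x hx' hgt (hloc.hasDerivAt_eq_zero (hd1 x hx'))
  have := nonpos_of_isLocalMax hloc
    (Filter.mem_of_superset (Ioo_mem_nhds hx'.1 hx'.2) hd1) (hd2 x hx')
  linarith

/-- A solution of `f'' + p f' = (c - V(f)) f` with `c` decreasing and `V` antitone that does not
exceed its right boundary value is monotone. -/
theorem deriv_nonneg_of_no_oscillation {c V : ℝ → ℝ} (hc : ContinuousOn f (Icc 0 1))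
    (h0 : f 0 ≤ 0) (h1 : ∀ r ∈ Icc (0:ℝ) 1, f r ≤ f 1)
    (hfp : ∀ r ∈ Ioo (0:ℝ) 1, 0 < f r)
    (hd1 : ∀ r ∈ Ioo (0:ℝ) 1, HasDerivAt f (f' r) r)
    (hd2 : ∀ r ∈ Ioo (0:ℝ) 1, HasDerivAt f' (f'' r) r)
    (hode : ∀ r ∈ Ioo (0:ℝ) 1, f' r = 0 → f'' r = (c r - V (f r)) * f r)
    (hcs : ∀ r ∈ Ioo (0:ℝ) 1, ∀ s ∈ Ioo (0:ℝ) 1, r < s → c s < c r)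
    (hV : ∀ y z, 0 ≤ y → y ≤ z → V z ≤ V y) :
    ∀ r ∈ Ioo (0:ℝ) 1, 0 ≤ f' r := by
  intro r hr
  by_contra! hneg
  have hev := (hasDerivAt_iff_tendsto_slope.1 (hd1 r hr)).eventually (gt_mem_nhds hneg)
  obtain ⟨a, ha, haf⟩ : ∃ a ∈ Ioo 0 r, f r < f a := by
    have h2 := (hev.filter_mono (nhdsLT_le_nhdsNE r)).and (Ioo_mem_nhdsLT hr.1)
    obtain ⟨a, h3, ha⟩ := h2.exists
    refine ⟨a, ha, ?_⟩
    rw [slope_def_field, div_neg_iff] at h3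
    rcases h3 with h3 | h3 <;> linarith [ha.2]
  obtain ⟨b, hb, hbf⟩ : ∃ b ∈ Ioo r 1, f b < f r := by
    have h2 := (hev.filter_mono (nhdsGT_le_nhdsNE r)).and (Ioo_mem_nhdsGT hr.2)
    obtain ⟨a, h3, ha⟩ := h2.exists
    refine ⟨a, ha, ?_⟩
    rw [slope_def_field, div_neg_iff] at h3
    rcases h3 with h3 | h3 <;> linarith [ha.1]
  -- If f decreases at r, then f has an interior maximum x left of r and an interior minimum y right
  -- of it, as f(0) ≤ 0 < f(r) and f ≤ f(1). The equation gives c(x) ≤ V(f x) and c(y) ≥ V(f y).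
  -- Since f(y) < f(x), also V(f y) ≥ V(f x), so c(y) ≥ c(x), against the strict decrease of c.
  obtain ⟨x, hx, hxmax⟩ := (isCompact_Icc (a := 0) (b := r)).exists_isMaxOn
    ⟨a, ha.1.le, ha.2.le⟩ (hc.mono (Icc_subset_Icc_right hr.2.le))
  obtain ⟨y, hy, hymin⟩ := (isCompact_Icc (a := r) (b := 1)).exists_isMinOn
    ⟨b, hb.1.le, hb.2.le⟩ (hc.mono (Icc_subset_Icc_left hr.1.le))
  have hxa : f a ≤ f x := hxmax ⟨ha.1.le, ha.2.le⟩
  have hyb : f y ≤ f b := hymin ⟨hb.1.le, hb.2.le⟩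
  have hfr := hfp r hr
  have hx' : x ∈ Ioo 0 r := by
    refine ⟨lt_of_le_of_ne hx.1 ?_, lt_of_le_of_ne hx.2 ?_⟩ <;> rintro rfl <;> linarith
  have hy' : y ∈ Ioo r 1 := by
    refine ⟨lt_of_le_of_ne hy.1 ?_, lt_of_le_of_ne hy.2 ?_⟩
    · rintro rfl; linarith
    · rintro rfl; linarith [h1 r ⟨hr.1.le, hr.2.le⟩]
  have hxI : x ∈ Ioo (0:ℝ) 1 := ⟨hx'.1, hx'.2.trans hr.2⟩
  have hyI : y ∈ Ioo (0:ℝ) 1 := ⟨hr.1.trans hy'.1, hy'.2⟩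
  have hxl : IsLocalMax f x := hxmax.isLocalMax (Icc_mem_nhds hx'.1 hx'.2)
  have hyl : IsLocalMin f y := hymin.isLocalMin (Icc_mem_nhds hy'.1 hy'.2)
  have e1 := nonpos_of_isLocalMax hxl
    (Filter.mem_of_superset (Ioo_mem_nhds hxI.1 hxI.2) hd1) (hd2 x hxI)
  have e2 := nonneg_of_isLocalMin hyl
    (Filter.mem_of_superset (Ioo_mem_nhds hyI.1 hyI.2) hd1) (hd2 y hyI)
  rw [hode x hxI (hxl.hasDerivAt_eq_zero (hd1 x hxI))] at e1
  rw [hode y hyI (hyl.hasDerivAt_eq_zero (hd1 y hyI))] at e2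
  have e3 : c x - V (f x) ≤ 0 := nonpos_of_mul_nonpos_left e1 (hfp x hxI)
  have e4 : 0 ≤ c y - V (f y) := nonneg_of_mul_nonneg_left e2 (hfp y hyI)
  have e5 := hcs x hxI y hyI (hx'.2.trans hy'.1)
  have e6 := hV (f y) (f x) (hfp y hyI).le (by linarith)
  linarith

end MaximumPrinciple

/-! ### Existence of the profile -/

/-- The data `F(r) = f(r)/r` and `m(r) = -F'(r)/r` attached to a radial profile `f`. -/
structure ProfileData (N : ℕ) (W : ℝ → ℝ) (ε : ℝ) (F m : ℝ → ℝ) : Prop where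
  continuous_m : Continuous m
  hasDerivAt_F : ∀ r, HasDerivAt F (-(r * m r)) r
  F_one : F 1 = 1
  one_le_F : ∀ r ∈ Icc (0:ℝ) 1, 1 ≤ F r
  m_nonneg : ∀ r ∈ Icc (0:ℝ) 1, 0 ≤ m r
  hasDerivAt_m : ∀ r ∈ Ioo (0:ℝ) 1,
    HasDerivAt m ((coeff W ε (r * F r) * F r - (N + 2) * m r) / r) r
  mul_le_one : ∀ r ∈ Icc (0:ℝ) 1, r * F r ≤ 1
  sq_mul_le : ∀ r ∈ Icc (0:ℝ) 1, r ^ 2 * m r ≤ F r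

variable {N : ℕ} {W : ℝ → ℝ} {ε : ℝ}

theorem hasDerivAt_mul_self {F : ℝ → ℝ} {r m : ℝ} (hF : HasDerivAt F (-(r * m)) r) :
    HasDerivAt (fun r => r * F r) (F r - r ^ 2 * m) r := by
  refine ((hasDerivAt_id' r).mul hF).congr_deriv ?_
  ring

/-- With f = rF one has f' = F - r²m, so this computes f''. -/
theorem hasDerivAt_sub_sq_mul {F m : ℝ → ℝ} {r q : ℝ} (hr : r ≠ 0)
    (hF : HasDerivAt F (-(r * m r)) r) (hm : HasDerivAt m ((q - (N + 2) * m r) / r) r) :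
    HasDerivAt (fun r => F r - r ^ 2 * m r) ((N - 1) * (r * m r) - r * q) r := by
  refine (hF.sub ((hasDerivAt_pow 2 r).mul hm)).congr_deriv ?_
  push_cast
  field_simp
  ring

theorem exists_profileData (hW : IsPotential W) (hN : 2 ≤ N) :
    ∃ F m, ProfileData N W ε F m := by
  -- Truncation makes the coefficient bounded, nonnegative and zero for |y| ≥ 1. It agrees with the
  -- true one on [0, 1], where rF will turn out to lie.
  set v : ℝ → ℝ := fun y => coeff W ε (min |y| 1) with hv
  have hvc : Continuous v := (hW.continuous_coeff ε).comp (by fun_prop)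
  have hv0 : ∀ y, 0 ≤ v y := fun y =>
    hW.coeff_nonneg ε (le_min (abs_nonneg y) zero_le_one) (min_le_right _ _)
  have hvC : ∀ y, v y ≤ coeff W ε 0 := fun y =>
    hW.coeff_antitone ε le_rfl (le_min (abs_nonneg y) zero_le_one)
  have hv1 : ∀ y, 1 ≤ y → v y = 0 := fun y hy => by
    simp only [hv, abs_of_nonneg (zero_le_one.trans hy), min_eq_right hy, hW.coeff_one]
  have hveq : ∀ y, 0 ≤ y → y ≤ 1 → v y = coeff W ε y := fun y h0 h1 => by
    simp only [hv, abs_of_nonneg h0, min_eq_left h1]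
  set h : ℝ → ℝ → ℝ := fun t y => v (t * y) * max y 0 with hh
  have hhc : Continuous (Function.uncurry h) := by
    simp only [Function.uncurry_def, hh]
    exact (hvc.comp (by fun_prop)).mul (by fun_prop)
  have hh0 : ∀ t y, 0 ≤ h t y := fun t y => mul_nonneg (hv0 _) (le_max_right _ _)
  have hhC : ∀ t y, 0 ≤ t → t * h t y ≤ coeff W ε 0 := by
    intro t y ht
    have hC0 := (hv0 0).trans (hvC 0)
    simp only [hh]
    rcases le_total y 0 with hy | hy
    · simpa [max_eq_right hy] using hC0
    · rw [max_eq_left hy]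
      rcases le_total (t * y) 1 with h1 | h1
      · calc t * (v (t * y) * y) = v (t * y) * (t * y) := by ring
          _ ≤ coeff W ε 0 * 1 := mul_le_mul (hvC _) h1 (mul_nonneg ht hy) hC0
          _ = coeff W ε 0 := mul_one _
      · simpa [hv1 _ h1] using hC0
  obtain ⟨F₀, hF₀c, hF₀1, hF₀⟩ :=
    exists_integral_solution (n := N + 1) hhc (Nat.succ_ne_zero N) hh0 hhC
  set m : ℝ → ℝ := fun r => ∫ τ in (0:ℝ)..1, τ ^ (N + 1) * h (r * τ) (F₀ (r * τ)) with hm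
  have hmc : Continuous m := by
    refine intervalIntegral.continuous_parametric_intervalIntegral_of_continuous'
      (f := fun (s : ℝ) (τ : ℝ) => τ ^ (N + 1) * h (s * τ) (F₀ (s * τ))) ?_ 0 1
    simp only [Function.uncurry_def]
    exact (continuous_snd.pow _).mul (hhc.comp₂ (by fun_prop) (hF₀c.comp (by fun_prop)))
  have hm0 : ∀ r, 0 ≤ m r := fun r =>
    intervalIntegral.integral_nonneg zero_le_one fun τ hτ =>
      mul_nonneg (pow_nonneg hτ.1 _) (hh0 _ _)
  set F : ℝ → ℝ := fun r => F₀ 0 - ∫ s in (0:ℝ)..r, s * m s with hF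
  have hsm : Continuous fun s : ℝ => s * m s := continuous_id.mul hmc
  have hFd : ∀ r, HasDerivAt F (-(r * m r)) r := fun r =>
    (intervalIntegral.integral_hasDerivAt_right (hsm.intervalIntegrable 0 r)
      (hsm.stronglyMeasurableAtFilter _ _) hsm.continuousAt).const_sub _
  have hFF₀ : ∀ r ∈ Icc (0:ℝ) 1, F₀ r = F r := fun r hr => hF₀ r hr
  have hFc : Continuous F := continuous_iff_continuousAt.2 fun r => (hFd r).continuousAt
  have hF1 : F 1 = 1 := by rw [← hFF₀ 1 (by simp), hF₀1]
  have hFanti : AntitoneOn F (Icc 0 1) := by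
    refine antitoneOn_of_deriv_nonpos (convex_Icc 0 1) hFc.continuousOn
      (fun r _ => (hFd r).differentiableAt.differentiableWithinAt) fun r hr => ?_
    rw [interior_Icc] at hr
    rw [(hFd r).deriv]
    linarith [mul_nonneg hr.1.le (hm0 r)]
  have hFge : ∀ r ∈ Icc (0:ℝ) 1, 1 ≤ F r := fun r hr => by
    rw [← hF1]; exact hFanti hr (by simp) hr.2
  have hmd : ∀ r ∈ Ioo (0:ℝ) 1, HasDerivAt m ((v (r * F r) * F r - (N + 2) * m r) / r) r := by
    intro r hr
    set k : ℝ → ℝ := fun t => t ^ (N + 1) * h t (F₀ t) with hk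
    have hkc : Continuous k :=
      (continuous_id.pow _).mul (hhc.comp₂ continuous_id hF₀c)
    have hmk : ∀ s, 0 < s → m s = (∫ t in (0:ℝ)..s, k t) / s ^ (N + 2) := by
      intro s hs
      have e := intervalIntegral.integral_comp_mul_left (a := 0) (b := 1) k hs.ne'
      have e2 : (∫ τ in (0:ℝ)..1, k (s * τ)) = s ^ (N + 1) * m s := by
        simp only [hm]
        rw [← intervalIntegral.integral_const_mul]
        refine intervalIntegral.integral_congr fun τ _ => ?_
        simp only [hk]; ring
      rw [e2] at e
      simp only [mul_zero, mul_one, smul_eq_mul] at e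
      rw [eq_div_iff (by positivity), pow_succ s (N + 1), ← mul_assoc, mul_comm (m s), e]
      field_simp
    have hd1 : HasDerivAt (fun s => ∫ t in (0:ℝ)..s, k t) (k r) r :=
      intervalIntegral.integral_hasDerivAt_right (hkc.intervalIntegrable 0 r)
        (hkc.stronglyMeasurableAtFilter _ _) hkc.continuousAt
    have hd2 := hd1.div (hasDerivAt_pow (N + 2) r) (by have := hr.1; positivity)
    have hd3 : HasDerivAt m _ r := hd2.congr_of_eventuallyEq
      (Filter.mem_of_superset (Ioi_mem_nhds hr.1) fun s hs => hmk s hs)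
    convert! hd3 using 1
    have hFr := hFge r ⟨hr.1.le, hr.2.le⟩
    have hint : (∫ t in (0:ℝ)..r, k t) = m r * r ^ (N + 2) := by
      rw [hmk r hr.1]; have := hr.1; field_simp
    rw [hint]
    have hkr : k r = r ^ (N + 1) * (v (r * F r) * F r) := by
      simp only [hk, hh]
      rw [hFF₀ r ⟨hr.1.le, hr.2.le⟩, max_eq_left (by linarith)]
    rw [hkr]
    have := hr.1
    push_cast
    field_simp
    ring
  have hfc : Continuous fun r => r * F r := continuous_id.mul hFc
  have hfd : ∀ r, HasDerivAt (fun r => r * F r) (F r - r ^ 2 * m r) r := fun r => hasDerivAt_mul_self (hFd r)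
  have hfdd : ∀ r ∈ Ioo (0:ℝ) 1, HasDerivAt (fun r => F r - r ^ 2 * m r)
      ((N - 1) * (r * m r) - r * (v (r * F r) * F r)) r := fun r hr =>
    hasDerivAt_sub_sq_mul hr.1.ne' (hFd r) (hmd r hr)
  have hN1 : (0:ℝ) < N - 1 := by
    have : (2:ℝ) ≤ N := by exact_mod_cast hN
    linarith
  have hle : ∀ r ∈ Icc (0:ℝ) 1, r * F r ≤ 1 := by
    refine le_one_of_max_principle hfc.continuousOn (by simp) (by simp [hF1])
      (fun r _ => hfd r) hfdd fun r hr hgt hz => ?_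
    have hr0 := hr.1
    have hFr := hFge r ⟨hr.1.le, hr.2.le⟩
    -- Where f > 1 the truncated coefficient vanishes, leaving f'' = (N-1) r m. At a critical point
    -- r²m = F ≥ 1, so m > 0.
    rw [hv1 _ hgt.le]
    have hm' : 0 < m r := by
      by_contra! hneg
      have := mul_nonneg (sq_nonneg r) (neg_nonneg.2 hneg)
      linarith
    have := mul_pos hN1 (mul_pos hr0 hm')
    linarith
  refine ⟨F, m, hmc, hFd, hF1, hFge, fun r _ => hm0 r, ?_, hle, ?_⟩
  · intro r hr
    have hr' : r ∈ Icc (0:ℝ) 1 := ⟨hr.1.le, hr.2.le⟩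
    rw [← hveq _ (mul_nonneg hr'.1 (zero_le_one.trans (hFge r hr'))) (hle r hr')]
    exact hmd r hr
  · have hnn : ∀ r ∈ Ioo (0:ℝ) 1, 0 ≤ F r - r ^ 2 * m r := by
      -- At a critical point of f one has m = F/r², which turns f'' into ((N-1)/r² - V(f)) f.
      refine deriv_nonneg_of_no_oscillation (f := fun r => r * F r)
        (c := fun r => (N - 1) / r ^ 2) (V := coeff W ε) hfc.continuousOn (by simp)
        (fun r hr => by simpa [hF1] using hle r hr)
        (fun r hr => mul_pos hr.1 (zero_lt_one.trans_le (hFge r ⟨hr.1.le, hr.2.le⟩)))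
        (fun r _ => hfd r) hfdd ?_ ?_ (fun y z hy hyz => hW.coeff_antitone ε hy hyz)
      · intro r hr hz
        have hr' : r ∈ Icc (0:ℝ) 1 := ⟨hr.1.le, hr.2.le⟩
        have hFr : F r = r ^ 2 * m r := by linarith
        rw [hveq _ (mul_nonneg hr'.1 (zero_le_one.trans (hFge r hr'))) (hle r hr')]
        have := hr.1
        have e : m r = F r / r ^ 2 := by rw [hFr]; field_simp
        rw [e]; field_simp
      · intro r hr s hs hrs
        exact div_lt_div_of_pos_left hN1 (pow_pos hr.1 2)
          (pow_lt_pow_left₀ hrs hr.1.le two_ne_zero)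
    intro r hr
    have hcl : IsClosed {r : ℝ | 0 ≤ F r - r ^ 2 * m r} :=
      isClosed_le continuous_const (hFc.sub ((continuous_id.pow 2).mul hmc))
    have hsub : Icc (0:ℝ) 1 ⊆ {r : ℝ | 0 ≤ F r - r ^ 2 * m r} := by
      rw [← closure_Ioo (zero_ne_one (α := ℝ))]
      exact closure_minimal hnn hcl
    have := hsub hr
    rw [Set.mem_ofPred_eq] at this
    linarith

theorem ProfileData.isRadialProfile (hW : IsPotential W) {F m : ℝ → ℝ}
    (hP : ProfileData N W ε F m) : IsRadialProfile N W ε (fun r => r * F r) := by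
  have hFc : Continuous F := continuous_iff_continuousAt.2 fun r => (hP.hasDerivAt_F r).continuousAt
  have hfd : ∀ r, HasDerivAt (fun r => r * F r) (F r - r ^ 2 * m r) r := fun r =>
    hasDerivAt_mul_self (hP.hasDerivAt_F r)
  have hderiv : deriv (fun r => r * F r) = fun r => F r - r ^ 2 * m r :=
    funext fun r => (hfd r).deriv
  have hfdd : ∀ r ∈ Ioo (0:ℝ) 1, HasDerivAt (fun r => F r - r ^ 2 * m r)
      ((N - 1) * (r * m r) - r * (coeff W ε (r * F r) * F r)) r := fun r hr =>
    hasDerivAt_sub_sq_mul hr.1.ne' (hP.hasDerivAt_F r) (hP.hasDerivAt_m r hr)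
  refine ⟨(continuous_id.mul hFc).continuousOn, ?_, fun r hr =>
    mul_nonneg hr.1 (zero_le_one.trans (hP.one_le_F r hr)), ?_, by simp, by simp [hP.F_one]⟩
  · rw [show (2 : WithTop ℕ∞) = 1 + 1 from one_add_one_eq_two.symm,
      contDiffOn_succ_iff_deriv_of_isOpen isOpen_Ioo]
    refine ⟨fun r _ => (hfd r).differentiableAt.differentiableWithinAt, by simp, ?_⟩
    rw [hderiv, show (1 : WithTop ℕ∞) = 0 + 1 from (zero_add 1).symm,
      contDiffOn_succ_iff_deriv_of_isOpen isOpen_Ioo]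
    refine ⟨fun r hr => (hfdd r hr).differentiableAt.differentiableWithinAt, by simp, ?_⟩
    rw [contDiffOn_zero]
    refine ContinuousOn.congr (f := fun r =>
      ((N:ℝ) - 1) * (r * m r) - r * (coeff W ε (r * F r) * F r)) ?_
      fun r hr => (hfdd r hr).deriv
    exact (continuous_const.mul (continuous_id.mul hP.continuous_m)).sub
      (continuous_id.mul (((hW.continuous_coeff ε).comp (continuous_id.mul hFc)).mul hFc))
      |>.continuousOn
  · intro r hr
    rw [hderiv, (hfdd r hr).deriv]
    have := hr.1
    simp only [coeff]
    field_simp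
    ring

end GinzburgLandau

/-! ### Uniqueness of the profile -/

namespace GinzburgLandau

theorem monotoneOn_of_hasDerivAt_interior {D : Set ℝ} (hD : Convex ℝ D) {f f' : ℝ → ℝ}
    (hc : ContinuousOn f D) (hd : ∀ x ∈ interior D, HasDerivAt f (f' x) x)
    (h0 : ∀ x ∈ interior D, 0 ≤ f' x) : MonotoneOn f D :=
  monotoneOn_of_hasDerivWithinAt_nonneg hD hc (fun x hx => (hd x hx).hasDerivWithinAt) h0

theorem antitoneOn_of_hasDerivAt_interior {D : Set ℝ} (hD : Convex ℝ D) {f f' : ℝ → ℝ}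
    (hc : ContinuousOn f D) (hd : ∀ x ∈ interior D, HasDerivAt f (f' x) x)
    (h0 : ∀ x ∈ interior D, f' x ≤ 0) : AntitoneOn f D :=
  antitoneOn_of_hasDerivWithinAt_nonpos hD hc (fun x hx => (hd x hx).hasDerivWithinAt) h0

variable {W : ℝ → ℝ} {ε : ℝ} {K N : ℕ} {f g : ℝ → ℝ}

theorem IsRadialProfile.hasDerivAt (hg : IsRadialProfile N W ε g) {r : ℝ} (hr : r ∈ Ioo (0:ℝ) 1) :
    HasDerivAt g (deriv g r) r :=
  ((hg.contDiffOn.differentiableOn two_ne_zero).differentiableAt (Ioo_mem_nhds hr.1 hr.2)).hasDerivAt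

theorem IsRadialProfile.hasDerivAt_deriv (hg : IsRadialProfile (K + 2) W ε g) {r : ℝ}
    (hr : r ∈ Ioo (0:ℝ) 1) :
    HasDerivAt (deriv g)
      (-((K + 1) / r * deriv g r) + (K + 1) / r ^ 2 * g r - coeff W ε (g r) * g r) r := by
  have h2 := hg.contDiffOn
  rw [show (2 : WithTop ℕ∞) = 1 + 1 from one_add_one_eq_two.symm,
    contDiffOn_succ_iff_deriv_of_isOpen isOpen_Ioo] at h2
  have h3 := ((h2.2.2.differentiableOn one_ne_zero).differentiableAt
    (Ioo_mem_nhds hr.1 hr.2)).hasDerivAt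
  convert! h3 using 1
  have := hg.ode r hr
  push_cast at this
  simp only [coeff]
  have e : ((K:ℝ) + 2 - 1) = K + 1 := by ring
  rw [e] at this
  linarith

theorem IsRadialProfile.le_one (hW : IsPotential W) (hg : IsRadialProfile (K + 2) W ε g) :
    ∀ r ∈ Icc (0:ℝ) 1, g r ≤ 1 := by
  refine le_one_of_max_principle hg.continuousOn (by simp [hg.map_zero]) (by simp [hg.map_one])
    (fun r hr => hg.hasDerivAt hr) (fun r hr => hg.hasDerivAt_deriv hr) fun r hr hgt hz => ?_
  have h1 : coeff W ε (g r) ≤ 0 := by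
    rw [← hW.coeff_one ε]; exact hW.coeff_antitone ε zero_le_one hgt.le
  have h2 : 0 < (K + 1) / r ^ 2 * g r := by have := hr.1; positivity
  rw [hz]
  nlinarith

/-- The flux `r^(N+1) (g/r)'`, for `N = K + 2`. -/
noncomputable def radialFlux (K : ℕ) (g : ℝ → ℝ) (r : ℝ) : ℝ :=
  r ^ (K + 2) * deriv g r - r ^ (K + 1) * g r

theorem IsRadialProfile.hasDerivAt_radialFlux (hg : IsRadialProfile (K + 2) W ε g) {r : ℝ}
    (hr : r ∈ Ioo (0:ℝ) 1) :
    HasDerivAt (radialFlux K g) (-(r ^ (K + 2) * (coeff W ε (g r) * g r))) r := by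
  refine (((hasDerivAt_pow (K + 2) r).mul (hg.hasDerivAt_deriv hr)).sub
    ((hasDerivAt_pow (K + 1) r).mul (hg.hasDerivAt hr))).congr_deriv ?_
  have := hr.1
  push_cast
  field_simp
  ring

theorem IsRadialProfile.hasDerivAt_div_self (hg : IsRadialProfile (K + 2) W ε g) {r : ℝ}
    (hr : r ∈ Ioo (0:ℝ) 1) :
    HasDerivAt (fun r => g r / r) (radialFlux K g r / r ^ (K + 3)) r := by
  refine ((hg.hasDerivAt hr).div (hasDerivAt_id' r) hr.1.ne').congr_deriv ?_
  have := hr.1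
  simp only [radialFlux]
  field_simp
  ring

theorem IsRadialProfile.coeff_mul_bounds (hW : IsPotential W)
    (hg : IsRadialProfile (K + 2) W ε g) {r : ℝ} (hr : r ∈ Ioo (0:ℝ) 1) :
    0 ≤ coeff W ε (g r) * g r ∧ coeff W ε (g r) * g r ≤ coeff W ε 0 := by
  have hr' := Ioo_subset_Icc_self hr
  have h0 := hg.nonneg r hr'
  have h1 := hg.le_one hW r hr'
  have h2 := hW.coeff_nonneg ε h0 h1
  refine ⟨mul_nonneg h2 h0, ?_⟩
  calc _ ≤ coeff W ε (g r) * 1 := mul_le_mul_of_nonneg_left h1 h2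
    _ ≤ _ := by rw [mul_one]; exact hW.coeff_antitone ε le_rfl h0

/-- The flux is decreasing, so a positive value c persists down to the origin. Then (g/r)' ≥ c/r²,
so g/r + c/r increases with r and stays bounded as r → 0. This contradicts g ≥ 0. -/
theorem IsRadialProfile.radialFlux_nonpos (hW : IsPotential W)
    (hg : IsRadialProfile (K + 2) W ε g) {r₁ : ℝ} (hr₁ : r₁ ∈ Ioo (0:ℝ) 1) :
    radialFlux K g r₁ ≤ 0 := by
  by_contra! hc
  set c := radialFlux K g r₁
  have hanti : AntitoneOn (radialFlux K g) (Ioo 0 1) := by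
    refine antitoneOn_of_hasDerivAt_interior (convex_Ioo 0 1)
      (fun r hr => (hg.hasDerivAt_radialFlux hr).continuousAt.continuousWithinAt)
      (fun r hr => hg.hasDerivAt_radialFlux (interior_subset hr)) fun r hr => ?_
    have hr' := interior_subset hr
    have h1 := (hg.coeff_mul_bounds hW hr').1
    have h2 := hr'.1
    rw [neg_nonpos]; positivity
  have hsub : ∀ r ∈ Ioc 0 r₁, r ∈ Ioo (0:ℝ) 1 := fun r hr => ⟨hr.1, hr.2.trans_lt hr₁.2⟩
  have hd : ∀ r ∈ Ioc 0 r₁, HasDerivAt (fun r => g r / r + c / r)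
      (radialFlux K g r / r ^ (K + 3) + (0 * r - c * 1) / r ^ 2) r := fun r hr =>
    (hg.hasDerivAt_div_self (hsub r hr)).add
      ((hasDerivAt_const r c).div (hasDerivAt_id' r) hr.1.ne')
  have hmono : MonotoneOn (fun r => g r / r + c / r) (Ioc 0 r₁) := by
    refine monotoneOn_of_hasDerivAt_interior (convex_Ioc 0 r₁)
      (fun r hr => (hd r hr).continuousAt.continuousWithinAt)
      (fun r hr => hd r (interior_subset hr)) fun r hr => ?_
    have hr' := interior_subset hr
    have h0 := hr'.1
    have h1 : c ≤ radialFlux K g r := hanti (hsub r hr') hr₁ hr'.2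
    have h2 : c / r ^ 2 ≤ c / r ^ (K + 3) :=
      div_le_div_of_nonneg_left hc.le (by positivity)
        (pow_le_pow_of_le_one h0.le (hsub r hr').2.le (by omega))
    have h3 : c / r ^ (K + 3) ≤ radialFlux K g r / r ^ (K + 3) :=
      div_le_div_of_nonneg_right h1 (by positivity)
    have h4 : (0 * r - c * 1) / r ^ 2 = -(c / r ^ 2) := by ring
    rw [h4]; linarith
  set B := g r₁ / r₁ + c / r₁
  have hB : 0 < B := add_pos_of_nonneg_of_pos
    (div_nonneg (hg.nonneg _ (Ioo_subset_Icc_self hr₁)) hr₁.1.le) (div_pos hc hr₁.1)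
  set r := min r₁ (c / (2 * B))
  have hr0 : 0 < r := lt_min hr₁.1 (by positivity)
  have hr : r ∈ Ioc 0 r₁ := ⟨hr0, min_le_left _ _⟩
  have h1 : g r / r + c / r ≤ B := hmono hr ⟨hr₁.1, le_rfl⟩ hr.2
  have h2 : 0 ≤ g r / r := div_nonneg (hg.nonneg _ (Ioo_subset_Icc_self (hsub r hr))) hr0.le
  have h3 : c / r ≤ B := by linarith
  rw [div_le_iff₀ hr0] at h3
  have h4 : B * r ≤ B * (c / (2 * B)) := mul_le_mul_of_nonneg_left (min_le_right _ _) hB.le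
  have h5 : B * (c / (2 * B)) = c / 2 := by field_simp
  linarith

/-- Here flux + C r^(K+3) is increasing, so a negative value -c persists down to the origin. Then
(g/r)' ≤ -c/r³, and g would grow at least like c/(2r), against g ≤ 1. -/
theorem IsRadialProfile.le_radialFlux (hW : IsPotential W)
    (hg : IsRadialProfile (K + 2) W ε g) {r₁ : ℝ} (hr₁ : r₁ ∈ Ioo (0:ℝ) 1) :
    -(coeff W ε 0 * r₁ ^ (K + 3)) ≤ radialFlux K g r₁ := by
  have hC0 : 0 ≤ coeff W ε 0 := hW.coeff_nonneg ε le_rfl zero_le_one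
  by_contra! hneg
  set C := coeff W ε 0
  obtain ⟨c, hc⟩ : ∃ c, c = -(radialFlux K g r₁ + C * r₁ ^ (K + 3)) := ⟨_, rfl⟩
  have hc0 : 0 < c := by linarith
  have hd1 : ∀ r ∈ Ioo (0:ℝ) 1, HasDerivAt (fun r => radialFlux K g r + C * r ^ (K + 3))
      (-(r ^ (K + 2) * (coeff W ε (g r) * g r)) + C * ((K + 3 : ℕ) * r ^ (K + 2))) r :=
    fun r hr => (hg.hasDerivAt_radialFlux hr).add ((hasDerivAt_pow (K + 3) r).const_mul C)
  have hmono : MonotoneOn (fun r => radialFlux K g r + C * r ^ (K + 3)) (Ioo 0 1) := by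
    refine monotoneOn_of_hasDerivAt_interior (convex_Ioo 0 1)
      (fun r hr => (hd1 r hr).continuousAt.continuousWithinAt)
      (fun r hr => hd1 r (interior_subset hr)) fun r hr => ?_
    have hr' := interior_subset hr
    have h1 := (hg.coeff_mul_bounds hW hr').2
    have h2 : (0:ℝ) ≤ r ^ (K + 2) := pow_nonneg hr'.1.le _
    have h3 := mul_le_mul_of_nonneg_left h1 h2
    have h4 : 0 ≤ r ^ (K + 2) * C * (K + 2) := by positivity
    push_cast
    nlinarith
  have hsub : ∀ r ∈ Ioc 0 r₁, r ∈ Ioo (0:ℝ) 1 := fun r hr => ⟨hr.1, hr.2.trans_lt hr₁.2⟩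
  have hd : ∀ r ∈ Ioc 0 r₁, HasDerivAt (fun r => g r / r - c / (2 * r ^ 2))
      (radialFlux K g r / r ^ (K + 3) + c / r ^ 3) r := fun r hr => by
    have h0 := hr.1
    refine ((hg.hasDerivAt_div_self (hsub r hr)).sub
      ((hasDerivAt_const r c).div ((hasDerivAt_pow 2 r).const_mul 2)
        (by positivity))).congr_deriv ?_
    push_cast
    field_simp
    ring
  have hanti : AntitoneOn (fun r => g r / r - c / (2 * r ^ 2)) (Ioc 0 r₁) := by
    refine antitoneOn_of_hasDerivAt_interior (convex_Ioc 0 r₁)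
      (fun r hr => (hd r hr).continuousAt.continuousWithinAt)
      (fun r hr => hd r (interior_subset hr)) fun r hr => ?_
    have hr' := interior_subset hr
    have h0 := hr'.1
    have h1 := hmono (hsub r hr') hr₁ hr'.2
    have h1' : 0 ≤ C * r ^ (K + 3) := by positivity
    have h1'' : radialFlux K g r ≤ -c := by simp only at h1; linarith
    have h2 : c / r ^ 3 ≤ c / r ^ (K + 3) :=
      div_le_div_of_nonneg_left hc0.le (by positivity)
        (pow_le_pow_of_le_one h0.le (hsub r hr').2.le (by omega))
    have h3 : radialFlux K g r / r ^ (K + 3) ≤ -c / r ^ (K + 3) :=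
      div_le_div_of_nonneg_right h1'' (by positivity)
    rw [neg_div] at h3
    linarith
  set B := g r₁ / r₁ - c / (2 * r₁ ^ 2)
  set r := min r₁ (c / (4 * (1 + |B|)))
  have hB0 := abs_nonneg B
  have hr0 : 0 < r := lt_min hr₁.1 (by positivity)
  have hr : r ∈ Ioc 0 r₁ := ⟨hr0, min_le_left _ _⟩
  have h1 : B ≤ g r / r - c / (2 * r ^ 2) := hanti hr ⟨hr₁.1, le_rfl⟩ hr.2
  have h2 : g r ≤ 1 := hg.le_one hW r (Ioo_subset_Icc_self (hsub r hr))
  have h3 : B * r + c / (2 * r) ≤ g r := by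
    have := mul_le_mul_of_nonneg_right h1 hr0.le
    have e : (g r / r - c / (2 * r ^ 2)) * r = g r - c / (2 * r) := by field_simp
    linarith
  have h4 : -|B| ≤ B * r := by
    have : |B * r| ≤ |B| := by
      rw [abs_mul, abs_of_pos hr0]
      exact mul_le_of_le_one_right hB0 (hsub r hr).2.le
    linarith [neg_abs_le (B * r)]
  have h5 : c / (2 * r) ≤ 1 + |B| := by linarith
  rw [div_le_iff₀ (by positivity)] at h5
  have h6 : (1 + |B|) * (2 * r) ≤ (1 + |B|) * (2 * (c / (4 * (1 + |B|)))) := by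
    have := min_le_right r₁ (c / (4 * (1 + |B|)))
    gcongr
  have h7 : (1 + |B|) * (2 * (c / (4 * (1 + |B|)))) = c / 2 := by field_simp; norm_num
  linarith

/-- Nonpositive flux means that g/r decreases to its value 1 at r = 1. In particular g > 0 on (0,
1], so quotients of profiles make sense. -/
theorem IsRadialProfile.self_le (hW : IsPotential W) (hg : IsRadialProfile (K + 2) W ε g) :
    ∀ r ∈ Ioc (0:ℝ) 1, r ≤ g r := by
  intro r hr
  have hanti : AntitoneOn (fun r => g r / r) (Ioc 0 1) := by
    refine antitoneOn_of_hasDerivAt_interior (convex_Ioc 0 1)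
      ((hg.continuousOn.mono Ioc_subset_Icc_self).div continuousOn_id fun x hx => hx.1.ne')
      (fun r hr => hg.hasDerivAt_div_self (by rwa [interior_Ioc] at hr)) fun r hr => ?_
    rw [interior_Ioc] at hr
    exact div_nonpos_of_nonpos_of_nonneg (hg.radialFlux_nonpos hW hr) (pow_nonneg hr.1.le _)
  have := hanti hr ⟨zero_lt_one, le_rfl⟩ hr.2
  simp only [hg.map_one, div_one] at this
  rwa [le_div_iff₀ hr.1, one_mul] at this

/-- If f > g on a maximal interval (a, b), the weighted Wronskian is increasing there and
nonnegative near a, so f/g increases up to b, where it is at most 1. -/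
theorem IsRadialProfile.le_of_profile (hW : IsPotential W) (hf : IsRadialProfile (K + 2) W ε f)
    (hg : IsRadialProfile (K + 2) W ε g) : ∀ r ∈ Icc (0:ℝ) 1, f r ≤ g r := by
  intro r₀ hr₀
  by_contra! hlt
  obtain ⟨a, ⟨haI, haf⟩, hamax⟩ : ∃ a, IsGreatest {x ∈ Icc 0 r₀ | f x ≤ g x} a := by
    refine IsCompact.exists_isGreatest ?_ ⟨0, ⟨le_rfl, hr₀.1⟩, by simp [hf.map_zero, hg.map_zero]⟩
    have hs : Icc 0 r₀ ⊆ Icc (0:ℝ) 1 := Icc_subset_Icc_right hr₀.2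
    exact isCompact_Icc.of_isClosed_subset (isClosed_Icc.isClosed_le (hf.continuousOn.mono hs)
      (hg.continuousOn.mono hs)) fun x hx => hx.1
  obtain ⟨b, ⟨hbI, hbf⟩, hbmin⟩ : ∃ b, IsLeast {x ∈ Icc r₀ 1 | f x ≤ g x} b := by
    refine IsCompact.exists_isLeast ?_ ⟨1, ⟨hr₀.2, le_rfl⟩, by simp [hf.map_one, hg.map_one]⟩
    have hs : Icc r₀ 1 ⊆ Icc (0:ℝ) 1 := Icc_subset_Icc_left hr₀.1
    exact isCompact_Icc.of_isClosed_subset (isClosed_Icc.isClosed_le (hf.continuousOn.mono hs)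
      (hg.continuousOn.mono hs)) fun x hx => hx.1
  have har : a < r₀ := lt_of_le_of_ne haI.2 (by rintro rfl; linarith)
  have hrb : r₀ < b := lt_of_le_of_ne hbI.1 (by rintro rfl; linarith)
  have hgt : ∀ x ∈ Ioo a b, g x < f x := by
    intro x hx
    by_contra! hle
    rcases le_total x r₀ with h | h
    · exact absurd (hamax ⟨⟨haI.1.trans hx.1.le, h⟩, hle⟩) (not_le.2 hx.1)
    · exact absurd (hbmin ⟨⟨h, hx.2.le.trans hbI.2⟩, hle⟩) (not_le.2 hx.2)
  have hab : ∀ x ∈ Ioo a b, x ∈ Ioo (0:ℝ) 1 := fun x hx =>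
    ⟨haI.1.trans_lt hx.1, hx.2.trans_le hbI.2⟩
  have hgpos : ∀ x ∈ Ioc (0:ℝ) 1, 0 < g x := fun x hx => hx.1.trans_le (hg.self_le hW x hx)
  have hcont : ContinuousOn (fun x => f x / g x) (Ioc 0 1) :=
    (hf.continuousOn.mono Ioc_subset_Icc_self).div (hg.continuousOn.mono Ioc_subset_Icc_self)
      fun x hx => (hgpos x hx).ne'
  -- The linear terms of the two equations cancel in w'; only fg(V(g) - V(f)) survives, and it is
  -- nonnegative where g < f. Moreover (f/g)' has the sign of w.
  set w : ℝ → ℝ := fun r => r ^ (K + 1) * (deriv f r * g r - deriv g r * f r) with hw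
  have hwd : ∀ r ∈ Ioo (0:ℝ) 1, HasDerivAt w
      (r ^ (K + 1) * (f r * g r * (coeff W ε (g r) - coeff W ε (f r)))) r := by
    intro r hr
    refine ((hasDerivAt_pow (K + 1) r).mul
      (((hf.hasDerivAt_deriv hr).mul (hg.hasDerivAt hr)).sub
        ((hg.hasDerivAt_deriv hr).mul (hf.hasDerivAt hr)))).congr_deriv ?_
    have := hr.1
    push_cast
    simp only [Pi.mul_apply, Pi.sub_apply]
    field_simp
    ring
  have hρd : ∀ r ∈ Ioo (0:ℝ) 1, HasDerivAt (fun x => f x / g x)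
      (w r / (r ^ (K + 1) * g r ^ 2)) r := by
    intro r hr
    have h1 := hgpos r ⟨hr.1, hr.2.le⟩
    refine ((hf.hasDerivAt hr).div (hg.hasDerivAt hr) h1.ne').congr_deriv ?_
    have := hr.1
    simp only [hw]
    field_simp
  have hwmono : MonotoneOn w (Ioo a b) := by
    refine monotoneOn_of_hasDerivAt_interior (convex_Ioo a b)
      (fun r hr => (hwd r (hab r hr)).continuousAt.continuousWithinAt)
      (fun r hr => hwd r (hab r (interior_subset hr))) fun r hr => ?_
    have hr' := interior_subset hr
    have h1 := hab r hr'
    have h2 := hg.nonneg r (Ioo_subset_Icc_self h1)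
    have h3 := hf.nonneg r (Ioo_subset_Icc_self h1)
    have h4 := hW.coeff_antitone ε h2 (hgt r hr').le
    have h5 := h1.1
    have h6 : 0 ≤ coeff W ε (g r) - coeff W ε (f r) := by linarith
    positivity
  have hw0 : ∀ r ∈ Ioo a b, 0 ≤ w r := by
    intro r₁ hr₁
    by_contra! hneg
    have hle : ∀ r ∈ Ioc a r₁, w r ≤ w r₁ := fun r hr =>
      hwmono ⟨hr.1, hr.2.trans_lt hr₁.2⟩ hr₁ hr.2
    have hr₁' := hab r₁ hr₁
    rcases haI.1.eq_or_lt with ha | ha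
    -- For a = 0 nothing is known about derivatives at the origin, but r w is the flux of f times g
    -- minus the flux of g times f. The flux bounds give w ≥ -C r^(K+2) ≥ -C r, which exceeds w(r₁)
    -- < 0 at the r chosen here.
    · set C := coeff W ε 0
      have hC0 : 0 ≤ C := hW.coeff_nonneg ε le_rfl zero_le_one
      set r := min r₁ (-w r₁ / (4 * C + 1))
      have hr0 : 0 < r := lt_min hr₁'.1 (div_pos (by linarith) (by linarith))
      have hrI : r ∈ Ioo (0:ℝ) 1 := ⟨hr0, (min_le_left _ _).trans_lt hr₁'.2⟩
      have h1 := hle r ⟨by rw [← ha]; exact hr0, min_le_left _ _⟩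
      have hP := hf.le_radialFlux hW hrI
      have hQ := hg.radialFlux_nonpos hW hrI
      have e : r * w r = radialFlux K f r * g r - radialFlux K g r * f r := by
        simp only [hw, radialFlux]; ring
      have hg1 := hg.le_one hW r (Ioo_subset_Icc_self hrI)
      have hg0 := hg.nonneg r (Ioo_subset_Icc_self hrI)
      have hf0 := hf.nonneg r (Ioo_subset_Icc_self hrI)
      have h2 : -(C * r ^ (K + 3)) ≤ r * w r := by
        have h3 : 0 ≤ -radialFlux K g r * f r := mul_nonneg (by linarith) hf0
        have h4 : -(C * r ^ (K + 3)) * g r ≤ radialFlux K f r * g r :=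
          mul_le_mul_of_nonneg_right hP hg0
        have h5 : (C * r ^ (K + 3)) * g r ≤ C * r ^ (K + 3) :=
          mul_le_of_le_one_right (by positivity) hg1
        linarith
      have h3 : -(C * r ^ (K + 2)) ≤ w r := by
        refine le_of_mul_le_mul_left ?_ hr0
        calc _ = -(C * r ^ (K + 3)) := by ring
          _ ≤ _ := h2
      have h4 : r ^ (K + 2) ≤ r := by
        calc r ^ (K + 2) ≤ r ^ 1 := pow_le_pow_of_le_one hr0.le hrI.2.le (by omega)
          _ = r := pow_one r
      have h5 : C * r ^ (K + 2) ≤ C * r := mul_le_mul_of_nonneg_left h4 hC0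
      have h6 : r * (4 * C + 1) ≤ -w r₁ := by
        rw [← le_div_iff₀ (by linarith)]; exact min_le_right _ _
      nlinarith
    -- For a > 0, negative w would make f/g decrease from f(a)/g(a) ≤ 1, against f > g inside.
    · have hanti : AntitoneOn (fun x => f x / g x) (Icc a r₁) := by
        refine antitoneOn_of_hasDerivAt_interior (convex_Icc a r₁)
          (f' := fun r => w r / (r ^ (K + 1) * g r ^ 2))
          (hcont.mono fun x hx => ⟨ha.trans_le hx.1, hx.2.trans hr₁'.2.le⟩)
          (fun r hr => ?_) fun r hr => ?_
        · rw [interior_Icc] at hr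
          exact hρd r (hab r ⟨hr.1, hr.2.trans hr₁.2⟩)
        · rw [interior_Icc] at hr
          have hr0 := (hab r ⟨hr.1, hr.2.trans hr₁.2⟩).1
          exact div_nonpos_of_nonpos_of_nonneg ((hle r ⟨hr.1, hr.2.le⟩).trans hneg.le)
            (by positivity)
      have h1 := hanti ⟨le_rfl, hr₁.1.le⟩ ⟨hr₁.1.le, le_rfl⟩ hr₁.1.le
      have h2 : f a / g a ≤ 1 :=
        (div_le_one (hgpos a ⟨ha, haI.2.trans hr₀.2⟩)).2 haf
      have h3 : 1 < f r₁ / g r₁ :=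
        (one_lt_div (hgpos r₁ ⟨hr₁'.1, hr₁'.2.le⟩)).2 (hgt r₁ hr₁)
      simp only at h1
      linarith
  have hr₀0 : 0 < r₀ := haI.1.trans_lt har
  have hmono : MonotoneOn (fun x => f x / g x) (Icc r₀ b) := by
    refine monotoneOn_of_hasDerivAt_interior (convex_Icc r₀ b)
      (f' := fun r => w r / (r ^ (K + 1) * g r ^ 2))
      (hcont.mono fun x hx => ⟨hr₀0.trans_le hx.1, hx.2.trans hbI.2⟩)
      (fun r hr => ?_) fun r hr => ?_
    · rw [interior_Icc] at hr
      exact hρd r (hab r ⟨har.trans hr.1, hr.2⟩)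
    · rw [interior_Icc] at hr
      have hr0 := hr₀0.trans hr.1
      have := hw0 r ⟨har.trans hr.1, hr.2⟩
      positivity
  have h1 := hmono ⟨le_rfl, hrb.le⟩ ⟨hrb.le, le_rfl⟩ hrb.le
  have h2 : f b / g b ≤ 1 := (div_le_one (hgpos b ⟨hr₀0.trans hrb, hbI.2⟩)).2 hbf
  have h3 : 1 < f r₀ / g r₀ := (one_lt_div (hgpos r₀ ⟨hr₀0, hr₀.2⟩)).2 hlt
  simp only at h1
  linarith

/-- Uniqueness of the radial profile. -/
theorem IsRadialProfile.eqOn (hW : IsPotential W) (hN : 2 ≤ N) (hf : IsRadialProfile N W ε f)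
    (hg : IsRadialProfile N W ε g) : EqOn f g (Icc 0 1) := by
  obtain ⟨K, rfl⟩ := Nat.exists_eq_add_of_le' hN
  exact fun r hr => le_antisymm (hf.le_of_profile hW hg r hr) (hg.le_of_profile hW hf r hr)

end GinzburgLandau

namespace GinzburgLandau

/-! ### Convergence in L² and passage to limits in bilinear integrals -/

section L2

variable {α : Type*} [MeasurableSpace α] {μ : Measure α}
  {H : Type*} [NormedAddCommGroup H]

/-- Vitali's theorem: a uniform bound on a finite measure space gives uniform integrability, since
the truncations above level C + 1 vanish. -/
theorem tendsto_eLpNorm_two_of_bounded [IsFiniteMeasure μ] {f : ℕ → α → H} {g : α → H} {C : ℝ}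
    (hf : ∀ k, AEStronglyMeasurable (f k) μ) (hg : MemLp g 2 μ)
    (hb : ∀ k, ∀ᵐ x ∂μ, ‖f k x‖ ≤ C)
    (hlim : ∀ᵐ x ∂μ, Tendsto (fun k => f k x) atTop (𝓝 (g x))) :
    Tendsto (fun k => eLpNorm (fun x => g x - f k x) 2 μ) atTop (𝓝 0) := by
  have h := tendsto_Lp_finite_of_tendsto_ae one_le_two ENNReal.ofNat_ne_top hf hg ?_ hlim
  · refine h.congr fun k => ?_
    rw [eLpNorm_sub_comm]; rfl
  · refine unifIntegrable_of one_le_two ENNReal.ofNat_ne_top hf fun δ _ =>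
      ⟨(C + 1).toNNReal, fun k => ?_⟩
    have : {x | (C + 1).toNNReal ≤ ‖f k x‖₊}.indicator (f k) =ᵐ[μ] 0 := by
      filter_upwards [hb k] with x hx
      refine Set.indicator_of_notMem ?_ _
      simp only [Set.mem_ofPred_eq, not_le]
      rw [← NNReal.coe_lt_coe, coe_nnnorm]
      exact (hx.trans_lt (lt_add_one C)).trans_le (Real.le_coe_toNNReal _)
    rw [eLpNorm_congr_ae this]
    simp

theorem tendsto_integral_inner [InnerProductSpace ℝ H] {f g : α → H} {fk gk : ℕ → α → H}
    (hf : MemLp f 2 μ) (hg : MemLp g 2 μ) (hfk : ∀ k, MemLp (fk k) 2 μ)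
    (hgk : ∀ k, MemLp (gk k) 2 μ)
    (hf' : Tendsto (fun k => eLpNorm (fun x => f x - fk k x) 2 μ) atTop (𝓝 0))
    (hg' : Tendsto (fun k => eLpNorm (fun x => g x - gk k x) 2 μ) atTop (𝓝 0)) :
    Tendsto (fun k => ∫ x, inner ℝ (fk k x) (gk k x) ∂μ) atTop (𝓝 (∫ x, inner ℝ (f x) (g x) ∂μ)) := by
  have key : ∀ {u : α → H} {uk : ℕ → α → H} (hu : MemLp u 2 μ) (huk : ∀ k, MemLp (uk k) 2 μ),
      Tendsto (fun k => eLpNorm (fun x => u x - uk k x) 2 μ) atTop (𝓝 0) →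
      Tendsto (fun k => (huk k).toLp (uk k)) atTop (𝓝 (hu.toLp u)) := by
    intro u uk hu huk h
    rw [Lp.tendsto_Lp_iff_tendsto_eLpNorm'']
    refine h.congr fun k => ?_
    rw [eLpNorm_sub_comm]; rfl
  have e : ∀ {u v : α → H} (hu : MemLp u 2 μ) (hv : MemLp v 2 μ),
      inner ℝ (hu.toLp u) (hv.toLp v) = ∫ x, inner ℝ (u x) (v x) ∂μ := by
    intro u v hu hv
    rw [L2.inner_def]
    refine integral_congr_ae ?_
    filter_upwards [hu.coeFn_toLp, hv.coeFn_toLp] with x h1 h2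
    rw [h1, h2]
  have := (key hf hfk hf').inner (𝕜 := ℝ) (key hg hgk hg')
  simpa only [e] using this

theorem integrable_inner_of_memLp [InnerProductSpace ℝ H] {f g : α → H} (hf : MemLp f 2 μ)
    (hg : MemLp g 2 μ) : Integrable (fun x => inner ℝ (f x) (g x)) μ := by
  refine (L2.integrable_inner (𝕜 := ℝ) (hf.toLp f) (hg.toLp g)).congr ?_
  filter_upwards [hf.coeFn_toLp, hg.coeFn_toLp] with x h1 h2
  rw [h1, h2]

theorem memLp_bdd_smul [NormedSpace ℝ H] {f : α → H} {V : α → ℝ} {C : ℝ} (hf : MemLp f 2 μ)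
    (hV : AEStronglyMeasurable V μ) (hC : ∀ᵐ x ∂μ, ‖V x‖ ≤ C) :
    MemLp (fun x => V x • f x) 2 μ := by
  refine MemLp.of_le (hf.const_smul C) (hV.smul hf.1) ?_
  filter_upwards [hC] with x hx
  rw [norm_smul, Pi.smul_apply, norm_smul]
  exact mul_le_mul_of_nonneg_right (hx.trans (le_abs_self C)) (norm_nonneg _)

theorem tendsto_eLpNorm_bdd_smul [NormedSpace ℝ H] {f : α → H} {fk : ℕ → α → H} {V : α → ℝ}
    {C : ℝ} (hC : ∀ᵐ x ∂μ, ‖V x‖ ≤ C)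
    (hf' : Tendsto (fun k => eLpNorm (fun x => f x - fk k x) 2 μ) atTop (𝓝 0)) :
    Tendsto (fun k => eLpNorm (fun x => V x • f x - V x • fk k x) 2 μ) atTop (𝓝 0) := by
  have h := ENNReal.Tendsto.const_mul (a := ENNReal.ofReal C) hf' (Or.inr ENNReal.ofReal_ne_top)
  rw [mul_zero] at h
  refine tendsto_of_tendsto_of_tendsto_of_le_of_le tendsto_const_nhds h (fun _ => zero_le) fun k => ?_
  refine eLpNorm_le_mul_eLpNorm_of_ae_le_mul ?_ 2
  filter_upwards [hC] with x hx
  rw [← smul_sub, norm_smul]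
  exact mul_le_mul_of_nonneg_right hx (norm_nonneg _)

end L2

variable {N M : ℕ}

instance : IsFiniteMeasure (ballMeasure N) :=
  ⟨by rw [ballMeasure, Measure.restrict_apply_univ]; exact measure_ball_lt_top⟩

theorem measurableSet_unitBall : MeasurableSet (unitBall N) := measurableSet_ball

theorem ae_mem_unitBall : ∀ᵐ x ∂(ballMeasure N), x ∈ unitBall N :=
  ae_restrict_mem measurableSet_unitBall

/-! ### Test functions and integration by parts on the ball -/

section TestFunctions

variable {F : Type*} [NormedAddCommGroup F] [NormedSpace ℝ F] {φ ψ : E N → F}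

theorem IsTestFunction.continuous_partialDeriv (hφ : IsTestFunction φ) (i : Fin N) :
    Continuous (partialDeriv i φ) :=
  (hφ.contDiff.continuous_fderiv (by simp)).clm_apply continuous_const

theorem IsTestFunction.hasCompactSupport_partialDeriv (hφ : IsTestFunction φ) (i : Fin N) :
    HasCompactSupport (partialDeriv i φ) :=
  hφ.hasCompactSupport.fderiv_apply (𝕜 := ℝ) _

theorem IsTestFunction.memLp (hφ : IsTestFunction φ) {p : ℝ≥0∞} : MemLp φ p (ballMeasure N) :=
  (hφ.contDiff.continuous.memLp_of_hasCompactSupport hφ.hasCompactSupport).restrict _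

theorem IsTestFunction.memLp_partialDeriv (hφ : IsTestFunction φ) (i : Fin N) {p : ℝ≥0∞} :
    MemLp (partialDeriv i φ) p (ballMeasure N) :=
  ((hφ.continuous_partialDeriv i).memLp_of_hasCompactSupport
    (hφ.hasCompactSupport_partialDeriv i)).restrict _

theorem IsTestFunction.differentiable (hφ : IsTestFunction φ) : Differentiable ℝ φ :=
  hφ.contDiff.differentiable (by simp)

theorem IsTestFunction.hasLineDerivAt (hφ : IsTestFunction φ) (i : Fin N) (x : E N) :
    HasLineDerivAt ℝ φ (partialDeriv i φ x) x (EuclideanSpace.single i 1) :=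
  (hφ.differentiable x).hasFDerivAt.hasLineDerivAt _

theorem IsTestFunction.partialDeriv_eq_zero (hφ : IsTestFunction φ) (i : Fin N) {x : E N}
    (hx : x ∉ unitBall N) : partialDeriv i φ x = 0 := by
  have h : x ∉ tsupport φ := fun h => hx (hφ.tsupport_subset h)
  rw [partialDeriv, fderiv_of_notMem_tsupport ℝ h]; simp

theorem IsTestFunction.eq_zero (hφ : IsTestFunction φ) {x : E N} (hx : x ∉ unitBall N) :
    φ x = 0 :=
  image_eq_zero_of_notMem_tsupport fun h => hx (hφ.tsupport_subset h)

theorem IsTestFunction.sub (hφ : IsTestFunction φ) (hψ : IsTestFunction ψ) :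
    IsTestFunction (fun x => φ x - ψ x) where
  contDiff := hφ.contDiff.sub hψ.contDiff
  hasCompactSupport := hφ.hasCompactSupport.sub hψ.hasCompactSupport
  tsupport_subset := (tsupport_sub φ ψ).trans (union_subset hφ.tsupport_subset hψ.tsupport_subset)

theorem IsTestFunction.partialDeriv_sub (hφ : IsTestFunction φ) (hψ : IsTestFunction ψ)
    (i : Fin N) (x : E N) :
    partialDeriv i (fun x => φ x - ψ x) x = partialDeriv i φ x - partialDeriv i ψ x := by
  simp only [partialDeriv]
  rw [fderiv_fun_sub (hφ.differentiable x) (hψ.differentiable x)]; simp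

variable {G K : Type*} [NormedAddCommGroup G] [NormedSpace ℝ G] [NormedAddCommGroup K]
  [NormedSpace ℝ K]

/-- Integration by parts on the ball for a bounded map with bounded line derivatives. -/
theorem integral_bilinear_partialDeriv (B : G →L[ℝ] F →L[ℝ] K) {A A' : E N → G} {i : Fin N} {C : ℝ}
    (hφ : IsTestFunction φ)
    (hA : ∀ x ∈ unitBall N, HasLineDerivAt ℝ A (A' x) x (EuclideanSpace.single i 1))
    (hAm : AEStronglyMeasurable A (ballMeasure N)) (hAb : ∀ x ∈ unitBall N, ‖A x‖ ≤ C)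
    (hA'm : AEStronglyMeasurable A' (ballMeasure N)) (hA'b : ∀ x ∈ unitBall N, ‖A' x‖ ≤ C) :
    ∫ x, B (A x) (partialDeriv i φ x) ∂(ballMeasure N)
      = -∫ x, B (A' x) (φ x) ∂(ballMeasure N) := by
  have hint : ∀ {a : E N → G} {p : E N → F}, AEStronglyMeasurable a (ballMeasure N) →
      (∀ x ∈ unitBall N, ‖a x‖ ≤ C) → MemLp p 1 (ballMeasure N) → (∀ x ∉ unitBall N, p x = 0) →
      Integrable (fun x => B (a x) (p x)) volume := by
    intro a p ham hab hp hp0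
    have hsupp : Function.support (fun x => B (a x) (p x)) ⊆ unitBall N := by
      intro x hx
      by_contra hx'
      exact hx (by simp [hp0 x hx'])
    rw [← integrableOn_iff_integrable_of_support_subset hsupp]
    refine Integrable.mono' ((memLp_one_iff_integrable.1 hp).norm.const_mul (‖B‖ * C))
      (B.aestronglyMeasurable_comp₂ ham hp.1) ?_
    filter_upwards [ae_mem_unitBall] with x hx
    refine (B.le_opNorm₂ _ _).trans ?_
    have := hab x hx
    gcongr
  have hset : ∀ {h : E N → K}, (∀ x ∉ unitBall N, h x = 0) →
      ∫ x, h x ∂(ballMeasure N) = ∫ x, h x := fun h0 =>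
    setIntegral_eq_integral_of_forall_compl_eq_zero h0
  rw [hset (fun x hx => by simp [hφ.partialDeriv_eq_zero i hx]),
    hset (fun x hx => by simp [hφ.eq_zero hx])]
  exact integral_bilinear_hasLineDerivAt_right_eq_neg_left_of_integrable
    (hint hA'm hA'b hφ.memLp fun x hx => hφ.eq_zero hx)
    (hint hAm hAb (hφ.memLp_partialDeriv i) fun x hx => hφ.partialDeriv_eq_zero i hx)
    (hint hAm hAb hφ.memLp fun x hx => hφ.eq_zero hx)
    (fun x hx => hA x (hφ.tsupport_subset hx)) (fun x _ => hφ.hasLineDerivAt i x)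

end TestFunctions

/-! ### Weak gradients and density in H¹₀ -/

section WeakGradient

variable {u v : E N → E M} {G G' : E N → Fin N → E M}

/-- The fundamental lemma of the calculus of variations. It permits replacing the chosen
`weakGradient` by explicit gradients. -/
theorem IsWeakGradient.ae_eq (hG : IsWeakGradient u G) (hG' : IsWeakGradient u G') (i : Fin N) :
    (fun x => G x i) =ᵐ[ballMeasure N] fun x => G' x i := by
  have hm := (hG.memLp i).sub (hG'.memLp i)
  have hloc : LocallyIntegrableOn ((fun x => G x i) - fun x => G' x i) (unitBall N) volume :=
    IntegrableOn.locallyIntegrableOn (hm.integrable one_le_two)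
  have h := Metric.isOpen_ball.ae_eq_zero_of_integral_contDiff_smul_eq_zero hloc fun φ h1 h2 h3 => ?_
  · have : ∀ᵐ x ∂(ballMeasure N), ((fun x => G x i) - fun x => G' x i) x = 0 :=
      (ae_restrict_iff' measurableSet_unitBall).2 h
    filter_upwards [this] with x hx
    exact sub_eq_zero.1 hx
  · have hφ : IsTestFunction φ := ⟨h1, h2, h3⟩
    have e : ∫ x, φ x • ((fun x => G x i) - fun x => G' x i) x
        = ∫ x, φ x • ((fun x => G x i) - fun x => G' x i) x ∂(ballMeasure N) :=
      (setIntegral_eq_integral_of_forall_compl_eq_zero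
        fun x hx => by rw [hφ.eq_zero hx, zero_smul]).symm
    have hi : ∀ {G : E N → Fin N → E M}, IsWeakGradient u G →
        Integrable (fun x => φ x • G x i) (ballMeasure N) := fun hG =>
      (hG.memLp i).smul (r := 1) (hφ.memLp (p := 2)) |> memLp_one_iff_integrable.1
    rw [e]
    simp only [Pi.sub_apply, smul_sub]
    rw [integral_sub (hi hG) (hi hG')]
    have h4 := hG.integral_eq φ hφ i
    have h5 := hG'.integral_eq φ hφ i
    rw [h4, neg_inj] at h5
    rw [h5, sub_self]

theorem IsWeakGradient.isWeakGradient_weakGradient (hG : IsWeakGradient u G) :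
    IsWeakGradient u (weakGradient u) := by
  have h : ∃ G, IsWeakGradient u G := ⟨G, hG⟩
  rw [weakGradient, dif_pos h]
  exact h.choose_spec

theorem IsWeakGradient.weakGradient_ae_eq (hG : IsWeakGradient u G) (i : Fin N) :
    (fun x => weakGradient u x i) =ᵐ[ballMeasure N] fun x => G x i :=
  hG.isWeakGradient_weakGradient.ae_eq hG i

theorem MemH1.isWeakGradient (hu : MemH1 u) : IsWeakGradient u (weakGradient u) :=
  hu.2.choose_spec.isWeakGradient_weakGradient

theorem IsWeakGradient.sub (hu : MemLp u 2 (ballMeasure N)) (hv : MemLp v 2 (ballMeasure N))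
    (hG : IsWeakGradient u G) (hG' : IsWeakGradient v G') :
    IsWeakGradient (fun x => u x - v x) (fun x i => G x i - G' x i) where
  memLp i := (hG.memLp i).sub (hG'.memLp i)
  integral_eq φ hφ i := by
    have hi : ∀ {a : E N → ℝ} {w : E N → E M}, MemLp a 2 (ballMeasure N) →
        MemLp w 2 (ballMeasure N) → Integrable (fun x => a x • w x) (ballMeasure N) :=
      fun ha hw => memLp_one_iff_integrable.1 (hw.smul (r := 1) ha)
    simp only [smul_sub]
    rw [integral_sub (hi (hφ.memLp_partialDeriv i) hu) (hi (hφ.memLp_partialDeriv i) hv),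
      integral_sub (hi hφ.memLp (hG.memLp i)) (hi hφ.memLp (hG'.memLp i)),
      hG.integral_eq φ hφ i, hG'.integral_eq φ hφ i]
    abel

theorem memH10_of_tendsto {φ : ℕ → E N → E M} (hu : MemLp u 2 (ballMeasure N))
    (hG : IsWeakGradient u G) (hφ : ∀ k, IsTestFunction (φ k))
    (h0 : Tendsto (fun k => eLpNorm (fun x => u x - φ k x) 2 (ballMeasure N)) atTop (𝓝 0))
    (h1 : ∀ i, Tendsto (fun k => eLpNorm (fun x => G x i - partialDeriv i (φ k) x) 2
      (ballMeasure N)) atTop (𝓝 0)) : MemH10 u := by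
  refine ⟨⟨hu, G, hG⟩, φ, hφ, h0, fun i => (h1 i).congr fun k => eLpNorm_congr_ae ?_⟩
  filter_upwards [hG.weakGradient_ae_eq i] with x hx
  rw [hx]

theorem tendsto_eLpNorm_sub_sub {f g : E N → E M} {fk gk : ℕ → E N → E M}
    (hf : MemLp f 2 (ballMeasure N)) (hg : MemLp g 2 (ballMeasure N))
    (hfk : ∀ k, MemLp (fk k) 2 (ballMeasure N)) (hgk : ∀ k, MemLp (gk k) 2 (ballMeasure N))
    (hf' : Tendsto (fun k => eLpNorm (fun x => f x - fk k x) 2 (ballMeasure N)) atTop (𝓝 0))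
    (hg' : Tendsto (fun k => eLpNorm (fun x => g x - gk k x) 2 (ballMeasure N)) atTop (𝓝 0)) :
    Tendsto (fun k => eLpNorm (fun x => (f x - g x) - (fk k x - gk k x)) 2 (ballMeasure N))
      atTop (𝓝 0) := by
  have h := hf'.add hg'
  rw [add_zero] at h
  refine tendsto_of_tendsto_of_tendsto_of_le_of_le tendsto_const_nhds h (fun _ => zero_le)
    fun k => ?_
  have e : (fun x => (f x - g x) - (fk k x - gk k x))
      = (fun x => f x - fk k x) - fun x => g x - gk k x := by
    ext1 x; simp only [Pi.sub_apply]; abel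
  rw [e]
  exact eLpNorm_sub_le (hf.sub (hfk k)).1 (hg.sub (hgk k)).1 one_le_two

theorem MemH10.sub (hu : MemH10 u) (hv : MemH10 v) : MemH10 (fun x => u x - v x) := by
  obtain ⟨hu1, φ, hφ, hφ0, hφ1⟩ := hu
  obtain ⟨hv1, ψ, hψ, hψ0, hψ1⟩ := hv
  refine memH10_of_tendsto (φ := fun k x => φ k x - ψ k x) (hu1.1.sub hv1.1)
    (hu1.isWeakGradient.sub hu1.1 hv1.1 hv1.isWeakGradient) (fun k => (hφ k).sub (hψ k)) ?_
    fun i => ?_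
  · exact tendsto_eLpNorm_sub_sub hu1.1 hv1.1 (fun k => (hφ k).memLp) (fun k => (hψ k).memLp)
      hφ0 hψ0
  · simp_rw [fun k x => (hφ k).partialDeriv_sub (hψ k) i x]
    exact tendsto_eLpNorm_sub_sub (hu1.isWeakGradient.memLp i) (hv1.isWeakGradient.memLp i)
      (fun k => (hφ k).memLp_partialDeriv i) (fun k => (hψ k).memLp_partialDeriv i)
      (hφ1 i) (hψ1 i)

/-- A weak equation tested with `C_c^∞` maps may be tested with `H¹₀` maps. -/
theorem MemH10.integral_eq_of_test {P : E N → Fin N → E M} {U : E N → E M}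
    (hP : ∀ i, MemLp (fun x => P x i) 2 (ballMeasure N)) (hU : MemLp U 2 (ballMeasure N))
    (h : ∀ φ : E N → E M, IsTestFunction φ →
      ∑ i, ∫ x, inner ℝ (P x i) (partialDeriv i φ x) ∂(ballMeasure N)
        = ∫ x, inner ℝ (U x) (φ x) ∂(ballMeasure N)) (hv : MemH10 v) :
    ∑ i, ∫ x, inner ℝ (P x i) (weakGradient v x i) ∂(ballMeasure N)
      = ∫ x, inner ℝ (U x) (v x) ∂(ballMeasure N) := by
  obtain ⟨hv1, φ, hφ, hφ0, hφ1⟩ := hv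
  have hz : ∀ f : E N → E M,
      Tendsto (fun _ : ℕ => eLpNorm (fun x => f x - f x) 2 (ballMeasure N)) atTop (𝓝 0) := by
    intro f; simp
  have h1 := tendsto_finsetSum Finset.univ fun i _ =>
    tendsto_integral_inner (hP i) (hv1.isWeakGradient.memLp i) (fun _ => hP i)
      (fun k => (hφ k).memLp_partialDeriv i) (hz _) (hφ1 i)
  have h2 := tendsto_integral_inner hU hv1.1 (fun _ => hU) (fun k => (hφ k).memLp) (hz _) hφ0
  refine tendsto_nhds_unique (h1.congr fun k => h (φ k) (hφ k)) h2

/-- A quadratic inequality for `C_c^∞` maps extends to `H¹₀` maps. -/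
theorem MemH10.le_of_test {V : E N → ℝ} {C c : ℝ} (hV : AEStronglyMeasurable V (ballMeasure N))
    (hC : ∀ x ∈ unitBall N, ‖V x‖ ≤ C)
    (h : ∀ φ : E N → E M, IsTestFunction φ →
      c * ∫ x, inner ℝ (φ x) (φ x) ∂(ballMeasure N)
        ≤ ∑ i, ∫ x, inner ℝ (partialDeriv i φ x) (partialDeriv i φ x) ∂(ballMeasure N)
          - ∫ x, inner ℝ (V x • φ x) (φ x) ∂(ballMeasure N)) (hv : MemH10 v) :
    c * ∫ x, inner ℝ (v x) (v x) ∂(ballMeasure N)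
      ≤ ∑ i, ∫ x, inner ℝ (weakGradient v x i) (weakGradient v x i) ∂(ballMeasure N)
        - ∫ x, inner ℝ (V x • v x) (v x) ∂(ballMeasure N) := by
  obtain ⟨hv1, φ, hφ, hφ0, hφ1⟩ := hv
  have hC' : ∀ᵐ x ∂(ballMeasure N), ‖V x‖ ≤ C := ae_mem_unitBall.mono hC
  have h1 := tendsto_finsetSum Finset.univ fun i _ =>
    tendsto_integral_inner (hv1.isWeakGradient.memLp i) (hv1.isWeakGradient.memLp i)
      (fun k => (hφ k).memLp_partialDeriv i) (fun k => (hφ k).memLp_partialDeriv i)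
      (hφ1 i) (hφ1 i)
  have h2 := tendsto_integral_inner hv1.1 hv1.1 (fun k => (hφ k).memLp) (fun k => (hφ k).memLp)
    hφ0 hφ0
  have h3 := tendsto_integral_inner (memLp_bdd_smul hv1.1 hV hC') hv1.1
    (fun k => memLp_bdd_smul (hφ k).memLp hV hC') (fun k => (hφ k).memLp)
    (tendsto_eLpNorm_bdd_smul hC' hφ0) hφ0
  exact le_of_tendsto_of_tendsto' (h2.const_mul c) (h1.sub h3) fun k => h (φ k) (hφ k)

end WeakGradient

end GinzburgLandau

namespace GinzburgLandau

variable {N M : ℕ}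

/-- The `i`-th standard basis vector. -/
noncomputable abbrev basisVec (i : Fin N) : E N := EuclideanSpace.single i 1

/-! ### Classical derivatives of radial maps -/

section Inclusion

/-- `incl N M` as a continuous linear map. -/
noncomputable def inclCLM (N M : ℕ) : E N →L[ℝ] E M :=
  LinearMap.toContinuousLinearMap
    { toFun := incl N M
      map_add' := fun x y => by
        ext j; simp only [incl, PiLp.add_apply]; split_ifs <;> simp
      map_smul' := fun c x => by
        ext j; simp only [incl, PiLp.smul_apply, RingHom.id_apply]; split_ifs <;> simp }

theorem inclCLM_apply (x : E N) : inclCLM N M x = incl N M x := rfl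

theorem continuous_incl : Continuous (incl N M) := (inclCLM N M).continuous

theorem incl_zero : incl N M 0 = 0 := map_zero (inclCLM N M)

theorem norm_incl (hNM : N ≤ M) (x : E N) : ‖incl N M x‖ = ‖x‖ := by
  obtain ⟨d, rfl⟩ := Nat.exists_eq_add_of_le hNM
  rw [EuclideanSpace.norm_eq, EuclideanSpace.norm_eq, Fin.sum_univ_add]
  simp [incl]

theorem sum_smul_incl_basisVec (x : E N) : ∑ i, x i • incl N M (basisVec i) = incl N M x := by
  have h : x = ∑ i, x i • basisVec i := by
    ext j
    simp [Pi.single_apply]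
  conv_rhs => rw [h, ← inclCLM_apply, map_sum]
  simp only [map_smul, inclCLM_apply]

end Inclusion

section LineDerivatives

theorem hasDerivAt_mul_of_continuousAt {c : ℝ → ℝ} (hc : ContinuousAt c 0) :
    HasDerivAt (fun t => c t * t) (c 0) 0 := by
  rw [hasDerivAt_iff_tendsto_slope]
  refine (hc.tendsto.mono_left nhdsWithin_le_nhds).congr' ?_
  filter_upwards [self_mem_nhdsWithin] with t ht
  have ht' : t ≠ 0 := ht
  rw [slope_def_field]
  field_simp
  ring

/-- The vanishing derivative removes the corner of |t|; this handles radial functions at the origin.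
-/
theorem hasDerivAt_comp_abs {F : ℝ → ℝ} (hF : HasDerivAt F 0 0) :
    HasDerivAt (fun t => F |t|) 0 0 := by
  rw [hasDerivAt_iff_isLittleO_nhds_zero] at hF ⊢
  have h0 : Tendsto (fun t : ℝ => |t|) (𝓝 0) (𝓝 0) := by
    simpa using (continuous_abs (G := ℝ)).tendsto 0
  have := (hF.comp_tendsto h0).trans_isBigO
    (Asymptotics.isBigO_abs_left.2 (Asymptotics.isBigO_refl (fun t : ℝ => t) (𝓝 0)))
  simpa [Function.comp_def] using this

theorem norm_add_smul_basisVec_zero (i : Fin N) (t : ℝ) : ‖(0 : E N) + t • basisVec i‖ = |t| := by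
  rw [zero_add, norm_smul, PiLp.norm_single]; simp

theorem hasLineDerivAt_norm_sq (x : E N) (i : Fin N) :
    HasLineDerivAt ℝ (fun y => ‖y‖ ^ 2) (2 * x i) x (basisVec i) := by
  have h1 : HasDerivAt (fun t : ℝ => x + t • basisVec i) (basisVec i) 0 := by
    simpa using ((hasDerivAt_id (0:ℝ)).smul_const (basisVec i)).const_add x
  refine h1.norm_sq.congr_deriv ?_
  simp [EuclideanSpace.inner_single_right]

theorem hasLineDerivAt_norm {x : E N} (hx : x ≠ 0) (i : Fin N) :
    HasLineDerivAt ℝ (fun y => ‖y‖) (x i / ‖x‖) x (basisVec i) := by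
  have hx' : 0 < ‖x‖ := norm_pos_iff.2 hx
  have h := (hasLineDerivAt_norm_sq x i)
  have h2 := HasDerivAt.sqrt h (by simpa using hx)
  simp only [Real.sqrt_sq (norm_nonneg _), zero_smul, add_zero] at h2
  refine h2.congr_deriv ?_
  field_simp

theorem hasLineDerivAt_coord (x : E N) (i : Fin N) :
    HasLineDerivAt ℝ (fun y => y i) 1 x (basisVec i) := by
  have h : HasDerivAt (fun t : ℝ => x i + t) 1 0 := (hasDerivAt_id (0:ℝ)).const_add (x i)
  refine h.congr_of_eventuallyEq (Eventually.of_forall fun t => ?_)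
  simp

theorem hasLineDerivAt_incl (x : E N) (i : Fin N) :
    HasLineDerivAt ℝ (incl N M) (incl N M (basisVec i)) x (basisVec i) :=
  ((inclCLM N M).hasFDerivAt (x := x)).hasLineDerivAt (basisVec i)

theorem hasLineDerivAt_comp_norm {F m : ℝ → ℝ} (hF : ∀ r, HasDerivAt F (-(r * m r)) r)
    (x : E N) (i : Fin N) :
    HasLineDerivAt ℝ (fun y => F ‖y‖) (-(m ‖x‖ * x i)) x (basisVec i) := by
  rcases eq_or_ne x 0 with rfl | hx
  · have h := hasDerivAt_comp_abs (F := F) (by simpa using hF 0)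
    rw [HasLineDerivAt]
    simp only [norm_add_smul_basisVec_zero]
    simpa using h
  · have hx' : 0 < ‖x‖ := norm_pos_iff.2 hx
    have h := HasDerivAt.comp_of_eq 0 (hF ‖x‖) (hasLineDerivAt_norm hx i) (by simp)
    refine h.congr_deriv ?_
    field_simp

/-- At the origin continuity of q suffices, because the factor y i supplies the differentiability.
The formula holds there with 0/0 = 0, giving the value q(0). -/
theorem hasLineDerivAt_radial_mul_coord {q k : ℝ → ℝ} (hq : ContinuousAt q 0)
    (hk : ∀ r ∈ Ioo (0:ℝ) 1, HasDerivAt q (k r / r) r) {x : E N} (hx1 : x ∈ unitBall N)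
    (i : Fin N) :
    HasLineDerivAt ℝ (fun y => q ‖y‖ * y i) (q ‖x‖ + k ‖x‖ * (x i ^ 2 / ‖x‖ ^ 2)) x
      (basisVec i) := by
  rcases eq_or_ne x 0 with rfl | hx
  · have h := hasDerivAt_mul_of_continuousAt (c := fun t => q |t|)
      (ContinuousAt.comp_of_eq hq continuous_abs.continuousAt abs_zero)
    rw [HasLineDerivAt]
    simp only [norm_add_smul_basisVec_zero]
    simpa using h
  · have hx' : 0 < ‖x‖ := norm_pos_iff.2 hx
    have hxI : ‖x‖ ∈ Ioo (0:ℝ) 1 := ⟨hx', by simpa [unitBall] using hx1⟩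
    have h := (HasDerivAt.comp_of_eq 0 (hk ‖x‖ hxI) (hasLineDerivAt_norm hx i) (by simp)).mul
      (hasLineDerivAt_coord x i)
    refine h.congr_deriv ?_
    simp only [Function.comp_apply, zero_smul, add_zero]
    field_simp
    ring

end LineDerivatives

section RadialMap

variable {W : ℝ → ℝ} {ε : ℝ} {F m : ℝ → ℝ}

theorem radialMap_mul_self (F : ℝ → ℝ) (x : E N) :
    radialMap N M (fun r => r * F r) x = F ‖x‖ • incl N M x := by
  rcases eq_or_ne x 0 with rfl | hx
  · simp [radialMap, incl_zero]
  · have hx' : ‖x‖ ≠ 0 := norm_ne_zero_iff.2 hx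
    simp only [radialMap]
    congr 1
    field_simp

/-- The classical gradient of `x ↦ F(|x|) x` when `F'(r) = -r m(r)`. -/
noncomputable def radialGrad (N M : ℕ) (F m : ℝ → ℝ) (x : E N) (i : Fin N) : E M :=
  F ‖x‖ • incl N M (basisVec i) - (m ‖x‖ * x i) • incl N M x

/-- The second derivative `∂ᵢ∂ᵢ` of `x ↦ F(|x|) x` when `F'(r) = -r m(r)` and `r m'(r) = k(r)`. -/
noncomputable def radialSecond (N M : ℕ) (m k : ℝ → ℝ) (x : E N) (i : Fin N) : E M :=
  -(m ‖x‖ * x i) • incl N M (basisVec i) -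
    ((m ‖x‖ * x i) • incl N M (basisVec i) +
      (m ‖x‖ + k ‖x‖ * (x i ^ 2 / ‖x‖ ^ 2)) • incl N M x)

theorem hasLineDerivAt_radial (hF : ∀ r, HasDerivAt F (-(r * m r)) r) (x : E N) (i : Fin N) :
    HasLineDerivAt ℝ (fun y => F ‖y‖ • incl N M y) (radialGrad N M F m x i) x (basisVec i) := by
  have h := HasDerivAt.smul (hasLineDerivAt_comp_norm hF x i) (hasLineDerivAt_incl (M := M) x i)
  refine h.congr_deriv ?_
  simp only [zero_smul, add_zero, radialGrad, neg_smul]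
  abel

theorem hasLineDerivAt_radialGrad (hF : ∀ r, HasDerivAt F (-(r * m r)) r) {k : ℝ → ℝ}
    (hm : ContinuousAt m 0) (hk : ∀ r ∈ Ioo (0:ℝ) 1, HasDerivAt m (k r / r) r) {x : E N}
    (hx : x ∈ unitBall N) (i : Fin N) :
    HasLineDerivAt ℝ (fun y => radialGrad N M F m y i) (radialSecond N M m k x i) x
      (basisVec i) := by
  have h1 := (hasLineDerivAt_comp_norm hF x i).smul_const (incl N M (basisVec i))
  have h2 := HasDerivAt.smul (hasLineDerivAt_radial_mul_coord hm hk hx i)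
    (hasLineDerivAt_incl (M := M) x i)
  refine (HasDerivAt.sub h1 h2).congr_deriv ?_
  simp only [zero_smul, add_zero, radialSecond]

/-- The Laplacian of F(|x|)x. With k = V F - (N+2) m it becomes -V F x, the Euler-Lagrange equation.
-/
theorem sum_radialSecond {k : ℝ → ℝ} (x : E N) :
    ∑ i, radialSecond N M m k x i = -(((N + 2) * m ‖x‖ + k ‖x‖) • incl N M x) := by
  rcases eq_or_ne x 0 with rfl | hx
  · simp [radialSecond, incl_zero]
  have hx' : ‖x‖ ≠ 0 := norm_ne_zero_iff.2 hx
  have h1 : ∑ i, (m ‖x‖ * x i) • incl N M (basisVec i) = m ‖x‖ • incl N M x := by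
    simp_rw [mul_smul, ← Finset.smul_sum, sum_smul_incl_basisVec]
  have h2 : ∑ i, (m ‖x‖ + k ‖x‖ * (x i ^ 2 / ‖x‖ ^ 2)) = N * m ‖x‖ + k ‖x‖ := by
    rw [Finset.sum_add_distrib, ← Finset.mul_sum, ← Finset.sum_div]
    have : ∑ i, x i ^ 2 = ‖x‖ ^ 2 := by
      rw [EuclideanSpace.norm_sq_eq]; simp
    rw [this]
    simp [hx']
  simp only [radialSecond, Finset.sum_sub_distrib, Finset.sum_add_distrib, neg_smul,
    Finset.sum_neg_distrib, h1, ← Finset.sum_smul, h2]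
  module

end RadialMap

end GinzburgLandau

/-! ### Smooth approximation and admissibility of the radial map -/

namespace GinzburgLandau

variable {N M : ℕ}

theorem exists_bound_on_unit {f : ℝ → ℝ} (hf : ContinuousOn f (Icc 0 1)) :
    ∃ C, 0 ≤ C ∧ ∀ r ∈ Icc (0:ℝ) 1, |f r| ≤ C := by
  obtain ⟨C, hC⟩ := isCompact_Icc.exists_bound_of_continuousOn hf
  exact ⟨|C|, abs_nonneg _, fun r hr => (hC r hr).trans (le_abs_self C)⟩

theorem norm_mem_unit {x : E N} (hx : x ∈ unitBall N) : ‖x‖ ∈ Icc (0:ℝ) 1 :=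
  ⟨norm_nonneg x, (by simpa [unitBall] using hx : ‖x‖ < 1).le⟩

theorem abs_coord_le (x : E N) (i : Fin N) : |x i| ≤ ‖x‖ := by
  simpa using PiLp.norm_apply_le x i

theorem norm_basisVec (i : Fin N) : ‖basisVec i‖ = 1 := by
  rw [PiLp.norm_single]; simp

section Approximation

/-- A `C¹` function on `[0,1]` vanishing at `1` is a bounded limit, together with its derivative,
of smooth functions vanishing near `1`. -/
theorem exists_smooth_approx {p : ℝ → ℝ} (hp : Continuous p) :
    ∃ Φ : ℕ → ℝ → ℝ, (∀ k, ContDiff ℝ ∞ (Φ k)) ∧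
      (∀ k, ∃ ρ < 1, ∀ s, ρ ≤ s → Φ k s = 0) ∧
      (∀ s ∈ Ico (0:ℝ) 1, Tendsto (fun k => Φ k s) atTop (𝓝 (-∫ t in s..1, p t))) ∧
      (∀ s ∈ Ico (0:ℝ) 1, Tendsto (fun k => deriv (Φ k) s) atTop (𝓝 (p s))) ∧
      ∃ C, 0 ≤ C ∧ ∀ k, ∀ s ∈ Icc (0:ℝ) 1, |Φ k s| ≤ C ∧ |deriv (Φ k) s| ≤ C := by
  obtain ⟨C, hC0, hC⟩ := exists_bound_on_unit hp.continuousOn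
  have hk : ∀ k : ℕ, (0:ℝ) < 1 / ((k:ℝ) + 1) := fun k => Nat.one_div_pos_of_nat
  choose P hP using fun k : ℕ => exists_polynomial_near_of_continuousOn 0 1 p hp.continuousOn
    (1 / ((k:ℝ) + 1)) (hk k)
  -- The cutoff is 0 for 1 - s ≤ 1/(k+1) and 1 for 1 - s ≥ 2/(k+1). Cutting off the derivative and
  -- then integrating from 1 keeps the derivatives bounded, unlike cutting off the function.
  set χ : ℕ → ℝ → ℝ := fun k s => Real.smoothTransition (((k:ℝ) + 1) * (1 - s) - 1) with hχ
  have hχd : ∀ k, ContDiff ℝ ∞ (χ k) := fun k =>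
    Real.smoothTransition.contDiff.comp (by fun_prop)
  set ψ : ℕ → ℝ → ℝ := fun k s => (P k).eval s * χ k s with hψ
  have hψd : ∀ k, ContDiff ℝ ∞ (ψ k) := fun k => by
    have h : ContDiff ℝ ∞ fun s => (P k).eval s := by
      simpa using (P k).contDiff_aeval (𝕜 := ℝ) ∞
    exact h.mul (hχd k)
  have hψc : ∀ k, Continuous (ψ k) := fun k => (hψd k).continuous
  have hd : ∀ k s, HasDerivAt (fun s => ∫ t in (1:ℝ)..s, ψ k t) (ψ k s) s := fun k s =>
    intervalIntegral.integral_hasDerivAt_right ((hψc k).intervalIntegrable 1 s)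
      ((hψc k).stronglyMeasurableAtFilter _ _) (hψc k).continuousAt
  have hderiv : ∀ k, deriv (fun s => ∫ t in (1:ℝ)..s, ψ k t) = ψ k := fun k =>
    funext fun s => (hd k s).deriv
  have hψb : ∀ k, ∀ s ∈ Icc (0:ℝ) 1, |ψ k s| ≤ C + 1 := by
    intro k s hs
    have h1 := hP k s hs
    have h2 : 1 / ((k:ℝ) + 1) ≤ 1 := by
      rw [div_le_one (by positivity)]; linarith [Nat.cast_nonneg (α := ℝ) k]
    have h3 : |(P k).eval s| ≤ C + 1 := by
      have := abs_sub_abs_le_abs_sub ((P k).eval s) (p s)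
      linarith [hC s hs]
    simp only [hψ, hχ, abs_mul, abs_of_nonneg (Real.smoothTransition.nonneg _)]
    exact (mul_le_of_le_one_right (abs_nonneg _) (Real.smoothTransition.le_one _)).trans h3
  have hψ1 : ∀ (k : ℕ) (s : ℝ), 1 - 1 / ((k:ℝ) + 1) ≤ s → ψ k s = 0 := by
    intro k s hs
    have h2 : ((k:ℝ) + 1) * (1 - s) - 1 ≤ 0 := by
      have h3 : 1 - s ≤ 1 / ((k:ℝ) + 1) := by linarith
      rw [le_div_iff₀ (by positivity)] at h3
      linarith
    simp only [hψ, hχ, Real.smoothTransition.zero_of_nonpos h2, mul_zero]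
  have hψlim : ∀ s ∈ Ico (0:ℝ) 1, Tendsto (fun k => ψ k s) atTop (𝓝 (p s)) := by
    intro s hs
    have h1 : Tendsto (fun k => (P k).eval s) atTop (𝓝 (p s)) := by
      rw [tendsto_iff_norm_sub_tendsto_zero]
      refine squeeze_zero (fun _ => norm_nonneg _) (fun k => (hP k s ⟨hs.1, hs.2.le⟩).le) ?_
      exact tendsto_one_div_add_atTop_nhds_zero_nat
    have h2 : (fun k => χ k s) =ᶠ[atTop] fun _ => 1 := by
      obtain ⟨n, hn⟩ := exists_nat_gt (2 / (1 - s))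
      have hs' : 0 < 1 - s := by linarith [hs.2]
      filter_upwards [eventually_ge_atTop n] with k hk
      refine Real.smoothTransition.one_of_one_le ?_
      rw [div_lt_iff₀ hs'] at hn
      have h3 : (n:ℝ) * (1 - s) ≤ ((k:ℝ) + 1) * (1 - s) := by
        have : (n:ℝ) ≤ k := by exact_mod_cast hk
        gcongr; linarith
      linarith
    simpa using h1.mul (tendsto_const_nhds.congr' h2.symm)
  refine ⟨fun k s => ∫ t in (1:ℝ)..s, ψ k t, ?_, ?_, ?_, ?_, C + 1, by linarith, ?_⟩
  · intro k
    rw [contDiff_infty_iff_deriv, hderiv]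
    exact ⟨fun s => (hd k s).differentiableAt, hψd k⟩
  · intro k
    refine ⟨1 - 1 / ((k:ℝ) + 1), by linarith [hk k], fun s hs => ?_⟩
    beta_reduce
    rw [intervalIntegral.integral_congr (g := fun _ => 0), intervalIntegral.integral_zero]
    intro t ht
    refine hψ1 k t ?_
    rw [uIcc] at ht
    exact (le_inf (by linarith [hk k]) hs).trans ht.1
  · intro s hs
    simp_rw [fun k => intervalIntegral.integral_symm (f := ψ k) (μ := volume) s 1]
    refine Tendsto.neg ?_
    refine intervalIntegral.tendsto_integral_filter_of_dominated_convergence (fun _ => C + 1) ?_ ?_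
      intervalIntegrable_const ?_
    · exact Eventually.of_forall fun k => (hψc k).aestronglyMeasurable
    · refine Eventually.of_forall fun k => Eventually.of_forall fun t ht => ?_
      rw [uIoc_of_le hs.2.le] at ht
      exact hψb k t ⟨hs.1.trans ht.1.le, ht.2⟩
    · have h1 : ∀ᵐ t : ℝ, t ≠ 1 := by simp [ae_iff]
      filter_upwards [h1] with t ht1 ht
      rw [uIoc_of_le hs.2.le] at ht
      exact hψlim t ⟨hs.1.trans ht.1.le, lt_of_le_of_ne ht.2 ht1⟩
  · intro s hs
    simp_rw [hderiv]
    exact hψlim s hs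
  · intro k s hs
    refine ⟨?_, by rw [hderiv]; exact hψb k s hs⟩
    have h := intervalIntegral.norm_integral_le_of_norm_le_const (a := 1) (b := s) (f := ψ k)
      (C := C + 1) fun t ht => by
        rw [uIoc_of_ge hs.2] at ht
        exact hψb k t ⟨hs.1.trans ht.1.le, ht.2⟩
    refine h.trans ?_
    rw [abs_of_nonpos (by linarith [hs.2])]
    nlinarith [hs.1]

end Approximation

section Admissible

variable {F m : ℝ → ℝ}

theorem isWeakGradient_of_hasLineDerivAt {u : E N → E M} {G : E N → Fin N → E M} {C : ℝ}
    (hd : ∀ i, ∀ x ∈ unitBall N, HasLineDerivAt ℝ u (G x i) x (basisVec i))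
    (hum : AEStronglyMeasurable u (ballMeasure N)) (hub : ∀ x ∈ unitBall N, ‖u x‖ ≤ C)
    (hGm : ∀ i, AEStronglyMeasurable (fun x => G x i) (ballMeasure N))
    (hGb : ∀ i, ∀ x ∈ unitBall N, ‖G x i‖ ≤ C) : IsWeakGradient u G where
  memLp i := MemLp.of_bound (hGm i) C (ae_mem_unitBall.mono (hGb i))
  integral_eq _ hφ i :=
    integral_bilinear_partialDeriv (ContinuousLinearMap.lsmul ℝ ℝ : ℝ →L[ℝ] E M →L[ℝ] E M).flip
      hφ (hd i) hum hub (hGm i) (hGb i)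

theorem continuous_radialGrad (hF : Continuous F) (hm : Continuous m) (i : Fin N) :
    Continuous fun x => radialGrad N M F m x i := by
  have h : Continuous (incl N M) := continuous_incl
  unfold radialGrad
  fun_prop

theorem continuous_radial (hF : Continuous F) : Continuous fun x => F ‖x‖ • incl N M x := by
  have h : Continuous (incl N M) := continuous_incl
  fun_prop

theorem norm_radial_le (hNM : N ≤ M) {a C : ℝ} (ha : |a| ≤ C) {x : E N} (hx : x ∈ unitBall N) :
    ‖a • incl N M x‖ ≤ C := by
  rw [norm_smul, norm_incl hNM, Real.norm_eq_abs]
  exact (mul_le_of_le_one_right (abs_nonneg _) (norm_mem_unit hx).2).trans ha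

theorem norm_gradient_le (hNM : N ≤ M) {a b C D : ℝ} (ha : |a| ≤ C) (hb : |b| ≤ D) {x : E N}
    (hx : x ∈ unitBall N) (i : Fin N) :
    ‖a • incl N M (basisVec i) - (b * x i) • incl N M x‖ ≤ C + D := by
  refine (norm_sub_le _ _).trans (add_le_add ?_ (norm_radial_le hNM ?_ hx))
  · rw [norm_smul, norm_incl hNM, norm_basisVec, mul_one]; exact ha
  · rw [abs_mul]
    exact (mul_le_of_le_one_right (abs_nonneg _)
      ((abs_coord_le x i).trans (norm_mem_unit hx).2)).trans hb

theorem isWeakGradient_radial (hNM : N ≤ M) (hF : ∀ r, HasDerivAt F (-(r * m r)) r)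
    (hm : Continuous m) :
    IsWeakGradient (fun x => F ‖x‖ • incl N M x) (radialGrad N M F m) := by
  have hFc : Continuous F := continuous_iff_continuousAt.2 fun r => (hF r).continuousAt
  obtain ⟨C, hC0, hC⟩ := exists_bound_on_unit hFc.continuousOn
  obtain ⟨D, hD0, hD⟩ := exists_bound_on_unit hm.continuousOn
  refine isWeakGradient_of_hasLineDerivAt (C := C + D) (fun i x _ => hasLineDerivAt_radial hF x i)
    (continuous_radial hFc).aestronglyMeasurable (fun x hx => ?_)
    (fun i => (continuous_radialGrad hFc hm i).aestronglyMeasurable) fun i x hx => ?_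
  · exact (norm_radial_le hNM (hC _ (norm_mem_unit hx)) hx).trans (by linarith)
  · exact norm_gradient_le hNM (hC _ (norm_mem_unit hx)) (hD _ (norm_mem_unit hx)) hx i

theorem memLp_radial (hNM : N ≤ M) (hF : Continuous F) :
    MemLp (fun x => F ‖x‖ • incl N M x) 2 (ballMeasure N) := by
  obtain ⟨C, hC0, hC⟩ := exists_bound_on_unit hF.continuousOn
  exact MemLp.of_bound (continuous_radial hF).aestronglyMeasurable C
    (ae_mem_unitBall.mono fun x hx => norm_radial_le hNM (hC _ (norm_mem_unit hx)) hx)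

theorem isTestFunction_radial {Φ : ℝ → ℝ} (hΦ : ContDiff ℝ ∞ Φ) {ρ : ℝ} (hρ : ρ < 1)
    (h0 : ∀ s, ρ ≤ s → Φ s = 0) :
    IsTestFunction (fun x : E N => Φ (‖x‖ ^ 2) • incl N M x) := by
  have hK : IsClosed {x : E N | ‖x‖ ^ 2 ≤ ρ} :=
    isClosed_le (by fun_prop) continuous_const
  have hKb : {x : E N | ‖x‖ ^ 2 ≤ ρ} ⊆ unitBall N := by
    intro x hx
    have hx' : ‖x‖ ^ 2 ≤ ρ := hx
    simp only [unitBall, mem_ball_zero_iff]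
    nlinarith [norm_nonneg x]
  have hsupp : tsupport (fun x : E N => Φ (‖x‖ ^ 2) • incl N M x) ⊆ {x : E N | ‖x‖ ^ 2 ≤ ρ} := by
    refine closure_minimal (fun x hx => ?_) hK
    by_contra hx'
    have hx'' : ρ < ‖x‖ ^ 2 := not_le.1 hx'
    exact hx (by simp [h0 _ hx''.le])
  refine ⟨?_, ?_, hsupp.trans hKb⟩
  · exact (hΦ.comp (contDiff_norm_sq ℝ)).smul (inclCLM N M).contDiff
  · exact IsCompact.of_isClosed_subset (isCompact_closedBall (0 : E N) 1) (isClosed_tsupport _)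
      ((hsupp.trans hKb).trans Metric.ball_subset_closedBall)

theorem partialDeriv_radial {Φ : ℝ → ℝ} (hΦ : ContDiff ℝ ∞ Φ) (x : E N) (i : Fin N) :
    partialDeriv i (fun x : E N => Φ (‖x‖ ^ 2) • incl N M x) x
      = Φ (‖x‖ ^ 2) • incl N M (basisVec i)
        - (-2 * deriv Φ (‖x‖ ^ 2) * x i) • incl N M x := by
  have hd : ContDiff ℝ ∞ (fun x : E N => Φ (‖x‖ ^ 2) • incl N M x) :=
    (hΦ.comp (contDiff_norm_sq ℝ)).smul (inclCLM N M).contDiff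
  have h1 := ((hd.differentiable (by simp) x).hasFDerivAt).hasLineDerivAt (basisVec i)
  have h2 := HasDerivAt.comp_of_eq 0
    (((hΦ.differentiable (by simp)) (‖x‖ ^ 2)).hasDerivAt) (hasLineDerivAt_norm_sq x i) (by simp)
  have h3 := HasDerivAt.smul h2 (hasLineDerivAt_incl (M := M) x i)
  rw [partialDeriv]
  refine (HasDerivAt.unique h1 h3).trans ?_
  simp only [Function.comp_apply, zero_smul, add_zero]
  module

theorem radial_sub_incl (F : ℝ → ℝ) (x : E N) :
    F ‖x‖ • incl N M x - incl N M x = (F ‖x‖ - 1) • incl N M x := by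
  rw [sub_smul, one_smul]

/-- F - 1 is approximated as a function of s = |x|² rather than |x|, so that the approximants are
smooth at the origin. -/
theorem memH10_radial_sub_incl (hNM : N ≤ M) (hF : ∀ r, HasDerivAt F (-(r * m r)) r)
    (hm : Continuous m) (hF1 : F 1 = 1) :
    MemH10 (fun x => F ‖x‖ • incl N M x - incl N M x) := by
  have hFc : Continuous F := continuous_iff_continuousAt.2 fun r => (hF r).continuousAt
  simp_rw [radial_sub_incl]
  set F' : ℝ → ℝ := fun r => F r - 1 with hF'
  have hF'd : ∀ r, HasDerivAt F' (-(r * m r)) r := fun r => (hF r).sub_const 1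
  have hF'c : Continuous F' := hFc.sub continuous_const
  -- This is the derivative of F(√s): the factor √s in F' cancels the singularity of √ at 0.
  set p : ℝ → ℝ := fun s => -(m (√s) / 2) with hp
  have hpc : Continuous p := ((hm.comp Real.continuous_sqrt).div_const 2).neg
  obtain ⟨Φ, hΦ, hΦ1, hΦlim, hΦ'lim, C, hC0, hC⟩ := exists_smooth_approx hpc
  have hFint : ∀ s ∈ Ico (0:ℝ) 1, -∫ t in s..1, p t = F' (√s) := by
    intro s hs
    have h := intervalIntegral.integral_eq_sub_of_hasDerivAt_of_le hs.2.le
      (f := fun s => F' (√s)) (f' := p) (hF'c.comp Real.continuous_sqrt).continuousOn ?_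
      (hpc.intervalIntegrable s 1)
    · rw [h]; simp [hF', hF1]
    · intro t ht
      have ht0 : 0 < t := hs.1.trans_lt ht.1
      refine ((hF'd (√t)).comp t (Real.hasDerivAt_sqrt ht0.ne')).congr_deriv ?_
      have : 0 < √t := Real.sqrt_pos.2 ht0
      simp only [hp]
      field_simp
  choose ρ hρ hρ0 using hΦ1
  have htest : ∀ k, IsTestFunction (fun x : E N => Φ k (‖x‖ ^ 2) • incl N M x) := fun k =>
    isTestFunction_radial (hΦ k) (hρ k) (hρ0 k)
  have hsq : ∀ {x : E N}, x ∈ unitBall N → ‖x‖ ^ 2 ∈ Ico (0:ℝ) 1 := by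
    intro x hx
    have : ‖x‖ < 1 := by simpa [unitBall] using hx
    exact ⟨by positivity, by nlinarith [norm_nonneg x]⟩
  have hlim0 : ∀ {x : E N}, x ∈ unitBall N →
      Tendsto (fun k => Φ k (‖x‖ ^ 2)) atTop (𝓝 (F' ‖x‖)) := by
    intro x hx
    have := hΦlim _ (hsq hx)
    rwa [hFint _ (hsq hx), Real.sqrt_sq (norm_nonneg x)] at this
  have hlim1 : ∀ {x : E N}, x ∈ unitBall N →
      Tendsto (fun k => -2 * deriv (Φ k) (‖x‖ ^ 2)) atTop (𝓝 (m ‖x‖)) := by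
    intro x hx
    have := (hΦ'lim _ (hsq hx)).const_mul (-2)
    simp only [hp, Real.sqrt_sq (norm_nonneg x)] at this
    convert! this using 2
    ring
  refine memH10_of_tendsto (memLp_radial hNM hF'c) (isWeakGradient_radial hNM hF'd hm) htest ?_
    fun i => ?_
  · refine tendsto_eLpNorm_two_of_bounded (C := C) (fun k => (htest k).memLp (p := 2) |>.1)
      (memLp_radial hNM hF'c) (fun k => ae_mem_unitBall.mono fun x hx => ?_)
      (ae_mem_unitBall.mono fun x hx => (hlim0 hx).smul_const _)
    exact norm_radial_le hNM (hC k _ ⟨(hsq hx).1, (hsq hx).2.le⟩).1 hx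
  · refine tendsto_eLpNorm_two_of_bounded (C := C + 2 * C)
      (fun k => ((htest k).memLp_partialDeriv i (p := 2)).1)
      ((isWeakGradient_radial hNM hF'd hm).memLp i)
      (fun k => ae_mem_unitBall.mono fun x hx => ?_)
      (ae_mem_unitBall.mono fun x hx => ?_)
    · rw [partialDeriv_radial (hΦ k)]
      have h := hC k _ ⟨(hsq hx).1, (hsq hx).2.le⟩
      refine norm_gradient_le hNM h.1 ?_ hx i
      rw [abs_mul]
      simpa using h.2
    · simp_rw [fun k => partialDeriv_radial (M := M) (hΦ k) x i]
      exact ((hlim0 hx).smul_const _).sub (((hlim1 hx).mul_const _).smul_const _)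

theorem radial_mem_admissible (hNM : N ≤ M) (hF : ∀ r, HasDerivAt F (-(r * m r)) r)
    (hm : Continuous m) (hF1 : F 1 = 1) :
    (fun x => F ‖x‖ • incl N M x) ∈ admissible N M :=
  ⟨⟨memLp_radial hNM (continuous_iff_continuousAt.2 fun r => (hF r).continuousAt), _,
    isWeakGradient_radial hNM hF hm⟩, memH10_radial_sub_incl hNM hF hm hF1⟩

end Admissible

end GinzburgLandau

/-! ### The Euler-Lagrange equation -/

namespace GinzburgLandau

variable {N M : ℕ} {W : ℝ → ℝ} {ε : ℝ} {F m : ℝ → ℝ}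

theorem ProfileData.continuous_F (hP : ProfileData N W ε F m) : Continuous F :=
  continuous_iff_continuousAt.2 fun r => (hP.hasDerivAt_F r).continuousAt

/-- The potential term `ε⁻² W'(1 - |u|²)` along the radial map `u`. -/
noncomputable def radialCoeff (W : ℝ → ℝ) (ε : ℝ) (F : ℝ → ℝ) (r : ℝ) : ℝ := coeff W ε (r * F r)

theorem continuous_radialCoeff (hW : IsPotential W) (hF : Continuous F) :
    Continuous (radialCoeff W ε F) :=
  (hW.continuous_coeff ε).comp (continuous_id.mul hF)

theorem ae_ne_zero (hN : N ≠ 0) : ∀ᵐ x ∂(ballMeasure N), x ≠ 0 := by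
  have : Nonempty (Fin N) := ⟨⟨0, Nat.pos_of_ne_zero hN⟩⟩
  exact ae_restrict_of_ae (by simp [ae_iff])

section EulerLagrange

theorem measurable_radialSecond {k : ℝ → ℝ} (hm : Continuous m) (hk : Continuous k) (i : Fin N) :
    Measurable fun x => radialSecond N M m k x i := by
  have h : Measurable (incl N M) := continuous_incl.measurable
  have hm' : Measurable m := hm.measurable
  have hk' : Measurable k := hk.measurable
  have hi : Measurable fun x : E N => x i := (by fun_prop : Continuous fun x : E N => x i).measurable
  unfold radialSecond
  fun_prop

theorem sq_div_sq_mem_unit (x : E N) (i : Fin N) : x i ^ 2 / ‖x‖ ^ 2 ∈ Icc (0:ℝ) 1 := by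
  refine ⟨by positivity, div_le_one_of_le₀ ?_ (by positivity)⟩
  exact sq_le_sq' (by linarith [neg_abs_le (x i), abs_coord_le x i])
    ((le_abs_self _).trans (abs_coord_le x i))

theorem norm_radialSecond_le (hNM : N ≤ M) {k : ℝ → ℝ} {C D : ℝ} {x : E N} (hx : x ∈ unitBall N)
    (hC : |m ‖x‖| ≤ C) (hD : |k ‖x‖| ≤ D) (i : Fin N) :
    ‖radialSecond N M m k x i‖ ≤ C + (C + (C + D)) := by
  have h1 : ‖(m ‖x‖ * x i) • incl N M (basisVec i)‖ ≤ C := by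
    rw [norm_smul, norm_incl hNM, norm_basisVec, mul_one, norm_mul]
    exact (mul_le_of_le_one_right (norm_nonneg _)
      ((abs_coord_le x i).trans (norm_mem_unit hx).2)).trans hC
  unfold radialSecond
  refine (norm_sub_le _ _).trans (add_le_add ?_ ((norm_add_le _ _).trans (add_le_add h1 ?_)))
  · rwa [neg_smul, norm_neg]
  · refine norm_radial_le hNM ((abs_add_le _ _).trans (add_le_add hC ?_)) hx
    have := sq_div_sq_mem_unit x i
    rw [abs_mul, abs_of_nonneg this.1]
    exact (mul_le_of_le_one_right (abs_nonneg _) this.2).trans hD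

theorem ProfileData.euler_lagrange (hW : IsPotential W) (hNM : N ≤ M)
    (hP : ProfileData N W ε F m) {φ : E N → E M} (hφ : IsTestFunction φ) :
    ∑ i, ∫ x, inner ℝ (radialGrad N M F m x i) (partialDeriv i φ x) ∂(ballMeasure N)
      = ∫ x, inner ℝ (radialCoeff W ε F ‖x‖ • (F ‖x‖ • incl N M x)) (φ x) ∂(ballMeasure N) := by
  have hFc := hP.continuous_F
  have hmc := hP.continuous_m
  set k : ℝ → ℝ := fun r => coeff W ε (r * F r) * F r - (N + 2) * m r with hk
  have hkc : Continuous k :=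
    ((continuous_radialCoeff (ε := ε) hW hFc).mul hFc).sub (continuous_const.mul hmc)
  obtain ⟨A, hA0, hA⟩ := exists_bound_on_unit hFc.continuousOn
  obtain ⟨C, hC0, hC⟩ := exists_bound_on_unit hmc.continuousOn
  obtain ⟨D, hD0, hD⟩ := exists_bound_on_unit hkc.continuousOn
  have hSm : ∀ i, AEStronglyMeasurable (fun x => radialSecond N M m k x i) (ballMeasure N) :=
    fun i => (measurable_radialSecond hmc hkc i).aestronglyMeasurable
  have hSb : ∀ i, ∀ x ∈ unitBall N, ‖radialSecond N M m k x i‖ ≤ C + (C + (C + D)) :=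
    fun i x hx => norm_radialSecond_le hNM hx (hC _ (norm_mem_unit hx)) (hD _ (norm_mem_unit hx)) i
  have hibp : ∀ i, ∫ x, inner ℝ (radialGrad N M F m x i) (partialDeriv i φ x) ∂(ballMeasure N)
      = -∫ x, inner ℝ (radialSecond N M m k x i) (φ x) ∂(ballMeasure N) := by
    intro i
    refine integral_bilinear_partialDeriv (innerSL ℝ (E := E M)) (C := (A + C) + (C + (C + (C + D))))
      hφ (fun x hx => hasLineDerivAt_radialGrad hP.hasDerivAt_F hmc.continuousAt hP.hasDerivAt_m hx i)
      (continuous_radialGrad hFc hmc i).aestronglyMeasurable (fun x hx => ?_) (hSm i)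
      (fun x hx => (hSb i x hx).trans (by linarith))
    exact (norm_gradient_le hNM (hA _ (norm_mem_unit hx)) (hC _ (norm_mem_unit hx)) hx i).trans
      (by linarith)
  have hSi : ∀ i, Integrable (fun x => inner ℝ (radialSecond N M m k x i) (φ x)) (ballMeasure N) :=
    fun i => integrable_inner_of_memLp
      (MemLp.of_bound (hSm i) _ (ae_mem_unitBall.mono (hSb i))) hφ.memLp
  simp_rw [hibp]
  rw [Finset.sum_neg_distrib, ← integral_finsetSum _ fun i _ => hSi i, ← integral_neg]
  refine integral_congr_ae (Eventually.of_forall fun x => ?_)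
  simp only
  rw [← sum_inner, sum_radialSecond, inner_neg_left, neg_neg, smul_smul]
  congr 2
  simp only [hk, radialCoeff]
  ring

end EulerLagrange

/-! ### The Hardy-type inequality -/

section Hardy

/-- With s = r² and b = m/F, this is div X - |X|² ≥ V + 1/16 for the field X of `ProfileData.hardy`.
The hypothesis s b ≤ 1 says f' ≥ 0. As δ → 0 the coefficient of 1/(s + δ) in the gap tends to κ² - 2
= (n² - 8n + 8)/4, which is at least 1/4 for n ≥ 7. -/
theorem hardy_pointwise {n s b B δ V : ℝ} (hn : 7 ≤ n) (hs : 0 < s) (hs1 : s ≤ 1) (hb : 0 ≤ b)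
    (hsb : s * b ≤ 1) (hbB : b ≤ B) (hδ : 0 < δ) (hδ1 : δ ≤ 1) (hδB : (n - 2) * (B * δ) ≤ 1 / 8) :
    V + 1 / 16 ≤ n * ((n - 4) / 2 / (s + δ) + b)
      + (-(2 * ((n - 4) / 2) * s / (s + δ) ^ 2) + (V - (n + 2) * b + s * b ^ 2))
      - s * ((n - 4) / 2 / (s + δ) + b) ^ 2 := by
  have hD : 0 < s + δ := by linarith
  obtain ⟨y, hy⟩ : ∃ y, y = 1 / (s + δ) := ⟨_, rfl⟩
  have hyD : s * y = 1 - δ * y := by rw [hy]; field_simp; ring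
  have hy0 : 0 < y := by rw [hy]; positivity
  have hy2 : 1 / 2 ≤ y := by rw [hy, div_le_div_iff₀ two_pos hD]; linarith
  have e1 : (n - 4) / 2 / (s + δ) = (n - 4) / 2 * y := by rw [hy]; ring
  have e2 : 2 * ((n - 4) / 2) * s / (s + δ) ^ 2 = (n - 4) * (s * y) * y := by
    rw [hy]; field_simp
  rw [e1, e2]
  obtain ⟨κ, hκ⟩ : ∃ κ, κ = (n - 4) / 2 := ⟨_, rfl⟩
  have hn4 : n - 4 = 2 * κ := by linarith
  rw [← hκ, hn4]
  have hκ0 : 0 < κ := by linarith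
  have hsy0 : 0 ≤ s * y := by positivity
  have hsy1 : s * y ≤ 1 := by rw [hyD]; nlinarith
  have h1 : κ * b * (s * y) ≤ κ * b := mul_le_of_le_one_right (by positivity) hsy1
  have h2 : (2 * κ + κ ^ 2) * y * (s * y) ≤ (2 * κ + κ ^ 2) * y :=
    mul_le_of_le_one_right (by positivity) hsy1
  have h3 : b ≤ (1 + B * δ) * y := by
    -- From (s + δ) y = 1: s b ≤ 1 bounds the first term, and the second is an error of order δ.
    have : b = s * b * y + b * δ * y := by
      have : s * y + δ * y = 1 := by linarith
      linear_combination -b * this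
    have h4 : s * b * y ≤ 1 * y := mul_le_mul_of_nonneg_right hsb hy0.le
    have h5 : b * δ * y ≤ B * δ * y := by gcongr
    linarith
  have h6 : (n - 2) * b ≤ (n - 2) * ((1 + B * δ) * y) :=
    mul_le_mul_of_nonneg_left h3 (by linarith)
  have h7 : (n - 2) * (B * δ) * y ≤ 1 / 8 * y := mul_le_mul_of_nonneg_right hδB hy0.le
  -- Of κ² - 2 ≥ 1/4, one eighth is reserved for the δ-error. The other eighth, with y ≥ 1/2, leaves
  -- the final 1/16.
  have h8 : 1 / 8 * y ≤ (n * κ - 2 * κ - κ ^ 2 - (n - 2) - 1 / 8) * y := by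
    refine mul_le_mul_of_nonneg_right ?_ hy0.le
    have : n = 2 * κ + 4 := by linarith
    subst this
    nlinarith
  have h9 : n * (κ * y + b) + (-(2 * κ * (s * y) * y) + (V - (n + 2) * b + s * b ^ 2))
      - s * (κ * y + b) ^ 2
      = V - 2 * b - 2 * (κ * b * (s * y)) + n * κ * y - (2 * κ + κ ^ 2) * y * (s * y) := by ring
  rw [h9]
  have h10 : (n - 2) * b = 2 * b + 2 * (κ * b) := by
    have : n = 2 * κ + 4 := by linarith
    subst this; ring
  nlinarith

theorem integrable_bdd_mul {a ψ : E N → ℝ} {C : ℝ} (ha : AEStronglyMeasurable a (ballMeasure N))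
    (hC : ∀ x ∈ unitBall N, |a x| ≤ C) (hψ : Integrable ψ (ballMeasure N)) :
    Integrable (fun x => a x * ψ x) (ballMeasure N) := by
  refine Integrable.mono' (hψ.norm.const_mul C) (ha.mul hψ.1) ?_
  filter_upwards [ae_mem_unitBall] with x hx
  rw [norm_mul]
  exact mul_le_mul_of_nonneg_right (hC x hx) (norm_nonneg _)

theorem IsTestFunction.inner_self {φ : E N → E M} (hφ : IsTestFunction φ) :
    IsTestFunction (fun x => (inner ℝ (φ x) (φ x) : ℝ)) := by
  have hs : tsupport (fun x => (inner ℝ (φ x) (φ x) : ℝ)) ⊆ tsupport φ := by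
    refine closure_mono fun x hx => ?_
    by_contra h
    exact hx (by simp [Function.notMem_support.1 h])
  exact ⟨hφ.contDiff.inner ℝ hφ.contDiff,
    hφ.hasCompactSupport.of_isClosed_subset (isClosed_tsupport _) hs, hs.trans hφ.tsupport_subset⟩

theorem IsTestFunction.partialDeriv_inner_self {φ : E N → E M} (hφ : IsTestFunction φ) (i : Fin N)
    (x : E N) : partialDeriv i (fun x => (inner ℝ (φ x) (φ x) : ℝ)) x
      = 2 * inner ℝ (φ x) (partialDeriv i φ x) := by
  have h1 := hφ.inner_self.hasLineDerivAt i x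
  have h2 := HasDerivAt.inner ℝ (hφ.hasLineDerivAt i x) (hφ.hasLineDerivAt i x)
  refine (HasDerivAt.unique h1 h2).trans ?_
  simp only [zero_smul, add_zero]
  rw [real_inner_comm (φ x)]
  ring

/-- If the vector field `X` satisfies `V + c ≤ div X - |X|²`, then
`∫ |∇φ|² - V |φ|² ≥ c ∫ |φ|²` for test maps `φ`. -/
theorem integral_grad_sq_ge {X X' : E N → Fin N → ℝ} {V : E N → ℝ} {C c : ℝ}
    (hd : ∀ i, ∀ x ∈ unitBall N, HasLineDerivAt ℝ (fun y => X y i) (X' x i) x (basisVec i))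
    (hXm : ∀ i, AEStronglyMeasurable (fun x => X x i) (ballMeasure N))
    (hXb : ∀ i, ∀ x ∈ unitBall N, |X x i| ≤ C)
    (hX'm : ∀ i, AEStronglyMeasurable (fun x => X' x i) (ballMeasure N))
    (hX'b : ∀ i, ∀ x ∈ unitBall N, |X' x i| ≤ C)
    (hVm : AEStronglyMeasurable V (ballMeasure N)) (hVb : ∀ x ∈ unitBall N, |V x| ≤ C)
    (hle : ∀ᵐ x ∂(ballMeasure N), V x + c ≤ ∑ i, X' x i - ∑ i, X x i ^ 2)
    {φ : E N → E M} (hφ : IsTestFunction φ) :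
    c * ∫ x, inner ℝ (φ x) (φ x) ∂(ballMeasure N)
      ≤ ∑ i, ∫ x, inner ℝ (partialDeriv i φ x) (partialDeriv i φ x) ∂(ballMeasure N)
        - ∫ x, inner ℝ (V x • φ x) (φ x) ∂(ballMeasure N) := by
  set μ := ballMeasure N
  set ψ : E N → ℝ := fun x => inner ℝ (φ x) (φ x) with hψ
  have hψt : IsTestFunction ψ := hφ.inner_self
  have hψi : Integrable ψ μ := memLp_one_iff_integrable.1 hψt.memLp
  have hψ'i : ∀ i, Integrable (partialDeriv i ψ) μ := fun i =>
    memLp_one_iff_integrable.1 (hψt.memLp_partialDeriv i)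
  have hgi : ∀ i, Integrable (fun x => (inner ℝ (partialDeriv i φ x) (partialDeriv i φ x) : ℝ)) μ :=
    fun i => integrable_inner_of_memLp (hφ.memLp_partialDeriv i) (hφ.memLp_partialDeriv i)
  have hibp : ∀ i, ∫ x, X x i * partialDeriv i ψ x ∂μ = -∫ x, X' x i * ψ x ∂μ := fun i =>
    integral_bilinear_partialDeriv (ContinuousLinearMap.mul ℝ ℝ) hψt (hd i) (hXm i) (hXb i)
      (hX'm i) (hX'b i)
  have hXd : ∀ i, Integrable (fun x => X x i * partialDeriv i ψ x) μ := fun i =>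
    integrable_bdd_mul (hXm i) (hXb i) (hψ'i i)
  have hX'ψ : ∀ i, Integrable (fun x => X' x i * ψ x) μ := fun i =>
    integrable_bdd_mul (hX'm i) (hX'b i) hψi
  have hXXψ : ∀ i, Integrable (fun x => X x i ^ 2 * ψ x) μ := fun i =>
    integrable_bdd_mul (C := C ^ 2) ((hXm i).pow 2)
      (fun x hx => by rw [abs_pow]; exact pow_le_pow_left₀ (abs_nonneg _) (hXb i x hx) 2) hψi
  have hpos : ∀ i, ∫ x, X' x i * ψ x ∂μ - ∫ x, X x i ^ 2 * ψ x ∂μ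
      ≤ ∫ x, inner ℝ (partialDeriv i φ x) (partialDeriv i φ x) ∂μ := by
    intro i
    -- The integrand is |∂ᵢφ + Xᵢφ|², whose cross term is Xᵢ ∂ᵢ|φ|².
    have h0 : 0 ≤ ∫ x, (inner ℝ (partialDeriv i φ x) (partialDeriv i φ x)
        + X x i * partialDeriv i ψ x) + X x i ^ 2 * ψ x ∂μ := by
      refine integral_nonneg fun x => ?_
      have e : (inner ℝ (partialDeriv i φ x) (partialDeriv i φ x)
          + X x i * partialDeriv i ψ x) + X x i ^ 2 * ψ x
          = inner ℝ (partialDeriv i φ x + X x i • φ x) (partialDeriv i φ x + X x i • φ x) := by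
        rw [hψ, hφ.partialDeriv_inner_self i x]
        simp only [inner_add_left, inner_add_right, real_inner_smul_left, real_inner_smul_right]
        rw [real_inner_comm (partialDeriv i φ x) (φ x)]
        ring
      simp only [e]
      exact real_inner_self_nonneg
    have hsplit := integral_add ((hgi i).add (hXd i)) (hXXψ i)
    simp only [Pi.add_apply] at hsplit
    rw [hsplit, integral_add (hgi i) (hXd i), hibp i] at h0
    linarith
  have hVψ : Integrable (fun x => V x * ψ x) μ := integrable_bdd_mul hVm hVb hψi
  have hsum := Finset.sum_le_sum fun i (_ : i ∈ Finset.univ) => hpos i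
  rw [Finset.sum_sub_distrib, ← integral_finsetSum _ fun i _ => hX'ψ i,
    ← integral_finsetSum _ fun i _ => hXXψ i, ← integral_sub
      (integrable_finsetSum _ fun i _ => hX'ψ i) (integrable_finsetSum _ fun i _ => hXXψ i)] at hsum
  have hfin : ∫ x, (V x * ψ x + c * ψ x) ∂μ
      ≤ ∫ x, (∑ i, X' x i * ψ x - ∑ i, X x i ^ 2 * ψ x) ∂μ := by
    refine integral_mono_ae (hVψ.add (hψi.const_mul c))
      ((integrable_finsetSum _ fun i _ => hX'ψ i).sub
        (integrable_finsetSum _ fun i _ => hXXψ i)) ?_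
    filter_upwards [hle] with x hx
    rw [← Finset.sum_mul, ← Finset.sum_mul, ← sub_mul, ← add_mul]
    exact mul_le_mul_of_nonneg_right hx real_inner_self_nonneg
  rw [integral_add hVψ (hψi.const_mul c), integral_const_mul] at hfin
  have e : ∫ x, inner ℝ (V x • φ x) (φ x) ∂μ = ∫ x, V x * ψ x ∂μ := by
    simp only [real_inner_smul_left, hψ]
  rw [e]
  linarith

/-- Apply `integral_grad_sq_ge` to X = q(|x|)x = -∇ log(F(r)(r² + δ)^(-κ/2)). Its divergence is N q
+ r q', and r q' = k contains V through the equation for m. -/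
theorem ProfileData.hardy (hW : IsPotential W) (hN : 7 ≤ N) (hP : ProfileData N W ε F m)
    {φ : E N → E M} (hφ : IsTestFunction φ) :
    1 / 16 * ∫ x, inner ℝ (φ x) (φ x) ∂(ballMeasure N)
      ≤ ∑ i, ∫ x, inner ℝ (partialDeriv i φ x) (partialDeriv i φ x) ∂(ballMeasure N)
        - ∫ x, inner ℝ (radialCoeff W ε F ‖x‖ • φ x) (φ x) ∂(ballMeasure N) := by
  have hFc := hP.continuous_F
  have hmc := hP.continuous_m
  have hn : (7:ℝ) ≤ N := by exact_mod_cast hN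
  have hF0 : ∀ r ∈ Icc (0:ℝ) 1, 0 < F r := fun r hr => zero_lt_one.trans_le (hP.one_le_F r hr)
  set V := radialCoeff W ε F with hV
  have hVc : Continuous V := continuous_radialCoeff hW hFc
  set b : ℝ → ℝ := fun r => m r / F r with hb
  have hbc : ContinuousOn b (Icc 0 1) :=
    hmc.continuousOn.div hFc.continuousOn fun r hr => (hF0 r hr).ne'
  obtain ⟨B, hB0, hB⟩ := exists_bound_on_unit hbc
  -- Small enough that (N-2) B δ ≤ 1/8, where B bounds m/F on [0, 1].
  set δ : ℝ := 1 / (8 * (N - 2) * (B + 1)) with hδ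
  have hden : 1 ≤ 8 * ((N:ℝ) - 2) * (B + 1) := by nlinarith
  have hδ0 : 0 < δ := by positivity
  have hδ1 : δ ≤ 1 := by rw [hδ, div_le_one (by linarith)]; exact hden
  have hδB : ((N:ℝ) - 2) * (B * δ) ≤ 1 / 8 := by
    rw [hδ, ← mul_assoc, mul_one_div, div_le_div_iff₀ (by linarith) (by norm_num)]
    nlinarith
  set κ : ℝ := ((N:ℝ) - 4) / 2 with hκ
  set q : ℝ → ℝ := fun r => κ / (r ^ 2 + δ) + b r with hq
  set k : ℝ → ℝ := fun r => -(2 * κ * r ^ 2 / (r ^ 2 + δ) ^ 2)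
    + (V r - (N + 2) * b r + r ^ 2 * b r ^ 2) with hk
  have hden' : ∀ r : ℝ, r ^ 2 + δ ≠ 0 := fun r => by positivity
  have hqc : ContinuousOn q (Icc 0 1) := by
    refine ContinuousOn.add (Continuous.continuousOn ?_) hbc
    exact continuous_const.div (by fun_prop) hden'
  have hkc : ContinuousOn k (Icc 0 1) := by
    refine ContinuousOn.add (Continuous.continuousOn ?_) ?_
    · exact (Continuous.div (by fun_prop) (by fun_prop) fun r => pow_ne_zero 2 (hden' r)).neg
    · exact (hVc.continuousOn.sub (continuousOn_const.mul hbc)).add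
        ((continuousOn_id.pow 2).mul (hbc.pow 2))
  have hqm : Measurable q := by
    have h1 := hFc.measurable
    have h2 := hmc.measurable
    simp only [hq, hb]
    fun_prop
  have hkm : Measurable k := by
    have h1 := hFc.measurable
    have h2 := hmc.measurable
    have h3 := hVc.measurable
    simp only [hk, hb]
    fun_prop
  have hq0 : ContinuousAt q 0 := by
    refine ContinuousAt.add (ContinuousAt.div continuousAt_const (by fun_prop) (hden' 0)) ?_
    exact hmc.continuousAt.div hFc.continuousAt (hF0 0 (by simp)).ne'
  have hqd : ∀ r ∈ Ioo (0:ℝ) 1, HasDerivAt q (k r / r) r := by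
    intro r hr
    have hFr := hF0 r (Ioo_subset_Icc_self hr)
    have h1 : HasDerivAt (fun r : ℝ => κ / (r ^ 2 + δ)) _ r :=
      (hasDerivAt_const r κ).div ((hasDerivAt_pow 2 r).add_const δ) (hden' r)
    have h2 := (hP.hasDerivAt_m r hr).div (hP.hasDerivAt_F r) hFr.ne'
    refine (h1.add h2).congr_deriv ?_
    have hr0 := hr.1
    simp only [hk, hb, hV, radialCoeff]
    have := hden' r
    push_cast
    field_simp
    ring
  obtain ⟨Q, hQ0, hQ⟩ := exists_bound_on_unit hqc
  obtain ⟨K, hK0, hK⟩ := exists_bound_on_unit hkc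
  obtain ⟨A, hA0, hA⟩ := exists_bound_on_unit hVc.continuousOn
  have hcoord : ∀ i : Fin N, Measurable fun x : E N => x i := fun i =>
    (by fun_prop : Continuous fun x : E N => x i).measurable
  refine integral_grad_sq_ge (X := fun x i => q ‖x‖ * x i)
    (X' := fun x i => q ‖x‖ + k ‖x‖ * (x i ^ 2 / ‖x‖ ^ 2)) (C := Q + K + A)
    (fun i x hx => hasLineDerivAt_radial_mul_coord hq0 hqd hx i) (fun i => ?_) (fun i x hx => ?_)
    (fun i => ?_) (fun i x hx => ?_)
    (hVc.comp continuous_norm).aestronglyMeasurable (fun x hx => ?_) ?_ hφ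
  · have := hcoord i
    exact (by fun_prop : Measurable fun x : E N => q ‖x‖ * x i).aestronglyMeasurable
  · rw [abs_mul]
    have h1 := hQ _ (norm_mem_unit hx)
    have h2 := mul_le_of_le_one_right (abs_nonneg (q ‖x‖))
      ((abs_coord_le x i).trans (norm_mem_unit hx).2)
    linarith
  · have := hcoord i
    exact (by fun_prop : Measurable fun x : E N =>
      q ‖x‖ + k ‖x‖ * (x i ^ 2 / ‖x‖ ^ 2)).aestronglyMeasurable
  · refine (abs_add_le _ _).trans ?_
    have h1 := hQ _ (norm_mem_unit hx)
    have h2 := hK _ (norm_mem_unit hx)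
    have h3 := sq_div_sq_mem_unit x i
    rw [abs_mul, abs_of_nonneg h3.1]
    have h4 := mul_le_of_le_one_right (abs_nonneg (k ‖x‖)) h3.2
    linarith
  · have := hA _ (norm_mem_unit hx)
    simp only [Function.comp_apply]
    linarith
  · filter_upwards [ae_mem_unitBall, ae_ne_zero (by omega)] with x hx hx0
    have hxI := norm_mem_unit hx
    have hx' : 0 < ‖x‖ := norm_pos_iff.2 hx0
    have hsum : ∑ i, x i ^ 2 = ‖x‖ ^ 2 := by rw [EuclideanSpace.norm_sq_eq]; simp
    have e1 : ∑ i, (q ‖x‖ + k ‖x‖ * (x i ^ 2 / ‖x‖ ^ 2)) = N * q ‖x‖ + k ‖x‖ := by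
      rw [Finset.sum_add_distrib, ← Finset.mul_sum, ← Finset.sum_div, hsum]
      simp [hx'.ne']
    have e2 : ∑ i, (q ‖x‖ * x i) ^ 2 = ‖x‖ ^ 2 * q ‖x‖ ^ 2 := by
      simp_rw [mul_pow]
      rw [← Finset.mul_sum, hsum, mul_comm]
    rw [e1, e2]
    have hFx := hF0 _ hxI
    refine hardy_pointwise (n := N) (s := ‖x‖ ^ 2) (b := b ‖x‖) (B := B) (δ := δ) hn
      (by positivity) (pow_le_one₀ hxI.1 hxI.2) (div_nonneg (hP.m_nonneg _ hxI) hFx.le) ?_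
      ((le_abs_self _).trans (hB _ hxI)) hδ0 hδ1 hδB
    simp only [hb]
    rw [← mul_div_assoc, div_le_one hFx]
    exact hP.sq_mul_le _ hxI

end Hardy

end GinzburgLandau

/-! ### Energy comparison and uniqueness of the minimizer -/

namespace GinzburgLandau

variable {N M : ℕ} {W : ℝ → ℝ} {ε : ℝ} {F m : ℝ → ℝ}

/-- g may change sign; `ENNReal.ofReal` discards its negative part. -/
theorem ofReal_integral_le_lintegral {α : Type*} [MeasurableSpace α] {μ : Measure α} {g : α → ℝ}
    (hg : Integrable g μ) : ENNReal.ofReal (∫ x, g x ∂μ) ≤ ∫⁻ x, ENNReal.ofReal (g x) ∂μ := by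
  calc ENNReal.ofReal (∫ x, g x ∂μ) ≤ ENNReal.ofReal (∫ x, max (g x) 0 ∂μ) :=
        ENNReal.ofReal_le_ofReal (integral_mono hg hg.pos_part fun x => le_max_left _ _)
    _ = ∫⁻ x, ENNReal.ofReal (max (g x) 0) ∂μ :=
        ofReal_integral_eq_lintegral_ofReal hg.pos_part
          (Eventually.of_forall fun x => le_max_right _ _)
    _ = ∫⁻ x, ENNReal.ofReal (g x) ∂μ := by
        refine lintegral_congr fun x => ?_
        rcases le_total (g x) 0 with h | h
        · rw [max_eq_right h, ENNReal.ofReal_zero, ENNReal.ofReal_of_nonpos h]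
        · rw [max_eq_left h]

/-- Convexity of the potential, in the form used to expand the energy. -/
theorem IsPotential.expand_le (hW : IsPotential W) (u v : E M) :
    1 / (2 * ε ^ 2) * W (1 - ‖u‖ ^ 2)
      - (inner ℝ (coeff W ε ‖u‖ • u) v + 1 / 2 * inner ℝ (coeff W ε ‖u‖ • v) v)
      ≤ 1 / (2 * ε ^ 2) * W (1 - ‖u + v‖ ^ 2) := by
  have h := hW.tangent_le (s := 1 - ‖u‖ ^ 2) (t := 1 - ‖u + v‖ ^ 2)
    (by nlinarith [sq_nonneg ‖u‖]) (by nlinarith [sq_nonneg ‖u + v‖])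
  have h2 := mul_le_mul_of_nonneg_left h (show 0 ≤ 1 / (2 * ε ^ 2) by positivity)
  refine le_trans (le_of_eq ?_) h2
  rw [norm_add_sq_real, real_inner_smul_left, real_inner_smul_left, real_inner_self_eq_norm_sq,
    coeff, show 1 / (2 * ε ^ 2) = 1 / 2 * (1 / ε ^ 2) by rw [one_div_mul_one_div]]
  ring

/-- Expand around u with v = w - u: the first variation integrates to zero, and the second, with its
factor 1/2, gives 1/2 · 1/16 = 1/32. -/
theorem ProfileData.energy_ge (hW : IsPotential W) (hN : 7 ≤ N) (hNM : N ≤ M)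
    (hP : ProfileData N W ε F m) {w : E N → E M} (hw : w ∈ admissible N M) :
    energy W ε (fun x : E N => F ‖x‖ • incl N M x)
      + ENNReal.ofReal (1 / 32 * ∫ x, ‖w x - F ‖x‖ • incl N M x‖ ^ 2 ∂(ballMeasure N))
      ≤ energy W ε w ∧ energy W ε (fun x : E N => F ‖x‖ • incl N M x) ≠ ⊤ := by
  have hFc := hP.continuous_F
  have hmc := hP.continuous_m
  set μ := ballMeasure N
  set u : E N → E M := fun x => F ‖x‖ • incl N M x with hu
  set Gu := radialGrad N M F m with hGu
  have huG : IsWeakGradient u Gu := isWeakGradient_radial hNM hP.hasDerivAt_F hmc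
  have huA : u ∈ admissible N M := radial_mem_admissible hNM hP.hasDerivAt_F hmc hP.F_one
  have huL : MemLp u 2 μ := huA.1.1
  set v : E N → E M := fun x => w x - u x with hv
  have hvH : MemH10 v := by
    have := hw.2.sub huA.2
    simpa only [sub_sub_sub_cancel_right] using this
  set Gw := weakGradient w with hGw
  set Gv := weakGradient v with hGv
  have hGvw : ∀ i, (fun x => Gv x i) =ᵐ[μ] fun x => Gw x i - Gu x i := fun i =>
    (hw.1.isWeakGradient.sub hw.1.1 huL huG).weakGradient_ae_eq i
  have hGv2 : ∀ i, MemLp (fun x => Gv x i) 2 μ := hvH.1.isWeakGradient.memLp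
  have hvL : MemLp v 2 μ := hvH.1.1
  set V : E N → ℝ := fun x => radialCoeff W ε F ‖x‖ with hV
  have hVc : Continuous (radialCoeff W ε F) := continuous_radialCoeff hW hFc
  have hVm : AEStronglyMeasurable V μ := (hVc.comp continuous_norm).aestronglyMeasurable
  obtain ⟨C, hC0, hC⟩ := exists_bound_on_unit hVc.continuousOn
  have hVb : ∀ x ∈ unitBall N, ‖V x‖ ≤ C := fun x hx => hC _ (norm_mem_unit hx)
  have hVb' : ∀ᵐ x ∂μ, ‖V x‖ ≤ C := ae_mem_unitBall.mono hVb
  have hVu : MemLp (fun x => V x • u x) 2 μ := memLp_bdd_smul huL hVm hVb'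
  have hVv : MemLp (fun x => V x • v x) 2 μ := memLp_bdd_smul hvL hVm hVb'
  have hEL : ∑ i, ∫ x, inner ℝ (Gu x i) (Gv x i) ∂μ = ∫ x, inner ℝ (V x • u x) (v x) ∂μ :=
    hvH.integral_eq_of_test huG.memLp hVu fun φ hφ => hP.euler_lagrange hW hNM hφ
  have hHardy := hvH.le_of_test hVm hVb fun φ hφ => hP.hardy hW hN hφ
  set eu : E N → ℝ := fun x => 1 / 2 * ∑ i, ‖Gu x i‖ ^ 2 + 1 / (2 * ε ^ 2) * W (1 - ‖u x‖ ^ 2)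
    with heu
  have hunorm : ∀ x, x ∈ unitBall N → ‖u x‖ = ‖x‖ * F ‖x‖ := by
    intro x hx
    have hFx : 0 ≤ F ‖x‖ := zero_le_one.trans (hP.one_le_F _ (norm_mem_unit hx))
    simp only [hu]
    rw [norm_smul, norm_incl hNM, Real.norm_of_nonneg hFx, mul_comm]
  have hW0 : ∀ t ≤ (1:ℝ), 0 ≤ W t := by
    intro t ht
    rcases eq_or_ne t 0 with rfl | h
    · exact hW.map_zero.ge
    · exact (hW.pos t ht h).le
  have h1u : ∀ x, 1 - ‖u x‖ ^ 2 ≤ 1 := fun x => by linarith [sq_nonneg ‖u x‖]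
  have heu0 : ∀ x, 0 ≤ eu x := fun x => by
    have := hW0 _ (h1u x)
    simp only [heu]
    positivity
  have hWu : Integrable (fun x => W (1 - ‖u x‖ ^ 2)) μ := by
    have hc : Continuous fun x => W (1 - ‖u x‖ ^ 2) :=
      hW.contDiffOn.continuousOn.comp_continuous
        (continuous_const.sub ((continuous_radial hFc).norm.pow 2)) h1u
    exact (hc.continuousOn.integrableOn_compact (isCompact_closedBall 0 1)).mono_set
      Metric.ball_subset_closedBall
  have heui : Integrable eu μ :=
    ((integrable_finsetSum _ fun i _ => (huG.memLp i).integrable_norm_pow two_ne_zero).const_mul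
      _).add (hWu.const_mul _)
  set R₁ : E N → ℝ := fun x => ∑ i, inner ℝ (Gu x i) (Gv x i) - inner ℝ (V x • u x) (v x) with hR₁
  set R₂ : E N → ℝ := fun x => ∑ i, inner ℝ (Gv x i) (Gv x i) - inner ℝ (V x • v x) (v x) with hR₂
  have hi₁ : ∀ i, Integrable (fun x => (inner ℝ (Gu x i) (Gv x i) : ℝ)) μ := fun i =>
    integrable_inner_of_memLp (huG.memLp i) (hGv2 i)
  have hi₂ : ∀ i, Integrable (fun x => (inner ℝ (Gv x i) (Gv x i) : ℝ)) μ := fun i =>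
    integrable_inner_of_memLp (hGv2 i) (hGv2 i)
  have hj₁ := integrable_inner_of_memLp hVu hvL
  have hj₂ := integrable_inner_of_memLp hVv hvL
  have hR₁i : Integrable R₁ μ := (integrable_finsetSum _ fun i _ => hi₁ i).sub hj₁
  have hR₂i : Integrable R₂ μ := (integrable_finsetSum _ fun i _ => hi₂ i).sub hj₂
  have hR₁0 : ∫ x, R₁ x ∂μ = 0 := by
    simp only [hR₁]
    rw [integral_sub (integrable_finsetSum _ fun i _ => hi₁ i) hj₁,
      integral_finsetSum _ fun i _ => hi₁ i, hEL, sub_self]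
  have hR₂0 : 1 / 16 * ∫ x, ‖v x‖ ^ 2 ∂μ ≤ ∫ x, R₂ x ∂μ := by
    simp only [hR₂]
    rw [integral_sub (integrable_finsetSum _ fun i _ => hi₂ i) hj₂,
      integral_finsetSum _ fun i _ => hi₂ i]
    simpa only [real_inner_self_eq_norm_sq] using hHardy
  -- The comparison is made pointwise because the energy of w may be infinite; only the lower bound
  -- has to be integrable.
  have hpt : ∀ᵐ x ∂μ, eu x + (R₁ x + 1 / 2 * R₂ x)
      ≤ 1 / 2 * ∑ i, ‖Gw x i‖ ^ 2 + 1 / (2 * ε ^ 2) * W (1 - ‖w x‖ ^ 2) := by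
    filter_upwards [ae_all_iff.2 hGvw, ae_mem_unitBall] with x hx hxB
    have hVx : V x = coeff W ε ‖u x‖ := by
      rw [hunorm x hxB]; rfl
    have hwx : w x = u x + v x := by simp only [hv]; abel
    have hpot := hW.expand_le (ε := ε) (u x) (v x)
    rw [← hwx, ← hVx] at hpot
    have hgrad : ∑ i, ‖Gw x i‖ ^ 2 = ∑ i, ‖Gu x i‖ ^ 2 + 2 * ∑ i, inner ℝ (Gu x i) (Gv x i)
        + ∑ i, inner ℝ (Gv x i) (Gv x i) := by
      rw [Finset.mul_sum, ← Finset.sum_add_distrib, ← Finset.sum_add_distrib]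
      refine Finset.sum_congr rfl fun i _ => ?_
      have : Gw x i = Gu x i + Gv x i := by rw [hx i]; abel
      rw [this, norm_add_sq_real, real_inner_self_eq_norm_sq]
    rw [hgrad]
    simp only [heu, hR₁, hR₂]
    linarith
  have hEu : energy W ε u = ENNReal.ofReal (∫ x, eu x ∂μ) := by
    rw [ofReal_integral_eq_lintegral_ofReal heui (Eventually.of_forall heu0)]
    refine lintegral_congr_ae ?_
    filter_upwards [ae_all_iff.2 huG.weakGradient_ae_eq] with x hx
    simp only [hx, heu]
  refine ⟨?_, by rw [hEu]; exact ENNReal.ofReal_ne_top⟩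
  have hv0 : 0 ≤ ∫ x, ‖v x‖ ^ 2 ∂μ := integral_nonneg fun x => sq_nonneg _
  rw [hEu, ← ENNReal.ofReal_add (integral_nonneg heu0) (by positivity)]
  have hRi : Integrable (fun x => R₁ x + 1 / 2 * R₂ x) μ := hR₁i.add (hR₂i.const_mul _)
  calc _ ≤ ENNReal.ofReal (∫ x, eu x + (R₁ x + 1 / 2 * R₂ x) ∂μ) := by
        refine ENNReal.ofReal_le_ofReal ?_
        rw [integral_add heui hRi, integral_add hR₁i (hR₂i.const_mul _), integral_const_mul, hR₁0]
        linarith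
    _ ≤ ∫⁻ x, ENNReal.ofReal (eu x + (R₁ x + 1 / 2 * R₂ x)) ∂μ :=
        ofReal_integral_le_lintegral (heui.add hRi)
    _ ≤ energy W ε w := lintegral_mono_ae (hpt.mono fun x hx => ENNReal.ofReal_le_ofReal hx)

theorem ProfileData.isGlobalMinimizer (hW : IsPotential W) (hN : 7 ≤ N) (hNM : N ≤ M)
    (hP : ProfileData N W ε F m) :
    IsGlobalMinimizer W ε (fun x : E N => F ‖x‖ • incl N M x) :=
  ⟨radial_mem_admissible hNM hP.hasDerivAt_F hP.continuous_m hP.F_one, fun _ hw =>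
    le_self_add.trans (hP.energy_ge hW hN hNM hw).1⟩

theorem ProfileData.ae_eq_of_isGlobalMinimizer (hW : IsPotential W) (hN : 7 ≤ N) (hNM : N ≤ M)
    (hP : ProfileData N W ε F m) {w : E N → E M} (hw : IsGlobalMinimizer W ε w) :
    w =ᵐ[ballMeasure N] fun x => F ‖x‖ • incl N M x := by
  have huA := radial_mem_admissible hNM hP.hasDerivAt_F hP.continuous_m hP.F_one
  obtain ⟨hge, hfin⟩ := hP.energy_ge hW hN hNM hw.1
  have h0 : ENNReal.ofReal
      (1 / 32 * ∫ x, ‖w x - F ‖x‖ • incl N M x‖ ^ 2 ∂(ballMeasure N)) ≤ 0 :=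
    -- Cancelling the common energy in [0, ∞] is legitimate because that of the radial map is
    -- finite.
    ENNReal.le_of_add_le_add_left hfin (by simpa using hge.trans (hw.2 _ huA))
  have h1 : ∫ x, ‖w x - F ‖x‖ • incl N M x‖ ^ 2 ∂(ballMeasure N) ≤ 0 := by
    have := ENNReal.ofReal_eq_zero.1 (nonpos_iff_eq_zero.1 h0)
    linarith
  have h2 : ∫ x, ‖w x - F ‖x‖ • incl N M x‖ ^ 2 ∂(ballMeasure N) = 0 :=
    le_antisymm h1 (integral_nonneg fun x => sq_nonneg _)
  have hi : Integrable (fun x => ‖w x - F ‖x‖ • incl N M x‖ ^ 2) (ballMeasure N) :=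
    (hw.1.1.1.sub huA.1.1).integrable_norm_pow two_ne_zero
  rw [integral_eq_zero_iff_of_nonneg (fun x => sq_nonneg _) hi] at h2
  filter_upwards [h2] with x hx
  have : ‖w x - F ‖x‖ • incl N M x‖ ^ 2 = 0 := hx
  simpa [sub_eq_zero] using this

end GinzburgLandau

open GinzburgLandau
theorem theorem2 (W : ℝ → ℝ) (hW : IsPotential W) (N M : ℕ) (hN : 7 ≤ N) (hNM : N ≤ M)
    (ε : ℝ) (hε : 0 < ε) :
    ∃ f : ℝ → ℝ, IsRadialProfile N W ε f ∧
      (∀ g : ℝ → ℝ, IsRadialProfile N W ε g → EqOn g f (Icc 0 1)) ∧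
      IsGlobalMinimizer W ε (radialMap N M f) ∧
      ∀ w : E N → E M, IsGlobalMinimizer W ε w → w =ᵐ[ballMeasure N] radialMap N M f := by
  obtain ⟨F, m, hP⟩ := exists_profileData (N := N) (ε := ε) hW (by omega)
  have hf := hP.isRadialProfile hW
  refine ⟨fun r => r * F r, hf, fun g hg => hg.eqOn hW (by omega) hf, ?_⟩
  rw [show radialMap N M (fun r => r * F r) = fun x => F ‖x‖ • incl N M x from
    funext (radialMap_mul_self F)]
  exact ⟨hP.isGlobalMinimizer hW hN hNM, fun w hw => hP.ae_eq_of_isGlobalMinimizer hW hN hNM hw⟩
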